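/- **Conventions.** All Fréchet spaces are real; manifolds are Hausdorff and without boundary; $C^k$ is meant in the sense of Keller's $C^k_c$-theory: a continuous map $f\colon U\to F$ on an open subset $U\subseteq E$ is $C^1$ if $df(x,y)=\frac{d}{dt}|_{t=0}f(x+ty)$ exists for all $(x,y)\in U\times E$ and $df\colon U\times E\to F$ is continuous; it is $C^{k}$ ($k\ge 2$) if moreover $df$ is $C^{k-1}$; $C^\infty$ (smooth) means $C^k$ for all $k$. For real $a<b$ and a Fréchet space $E$, let $\mathcal L^1([a,b],E)$ be the set of Borel measurable $\gamma\colon[a,b]\to E$ with separable image such that $\int_{[a,b]}q(\gamma(t))\,dt<\infty$ for each continuous seminorm $q$ on $E$. A function $\eta\colon[a,b]\to E$ is *absolutely continuous* if there is $\gamma\in\mathcal L^1([a,b],E)$ with $\eta(t)=\eta(a)+\int_a^t\gamma(s)\,ds$ (weak integral) for all $t\in[a,b]$. A continuous map $\eta\colon I\to M$ from a non-degenerate interval to a Fréchet manifold is *absolutely continuous* if each $t_0\in I$ lies in the interior, relative to $I$, of some $[\alpha,\beta]\subseteq I$ with $\alpha<\beta$ such that $\eta([\alpha,\beta])$ lies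 in the domain of a chart $\phi$ and $\phi\circ\eta|_{[\alpha,\beta]}$ is absolutely continuous. Let $J\subseteq\mathbb R$ be a non-degenerate interval, $W\subseteq J\times M$ be relatively open and $f\colon W\to TM$ with $f(t,y)\in T_yM$. A *Carathéodory solution* to $\dot y(t)=f(t,y(t))$ is an absolutely continuous $y\colon I\to M$ on a non-degenerate interval $I$ with $(t,y(t))\in W$ for all $t\in I$ and $\dot y(t)=f(t,y(t))$ for almost all $t\in I$; it solves the initial value problem with data $(t_0,y_0)$ if also $t_0\in I$ and $y(t_0)=y_0$. * *Local existence*: for each $(t_0,y_0)\in W$ there is a Carathéodory solution with $y(t_0)=y_0$ on a relatively open subinterval of $J$. * *Local uniqueness*: if $y_1\colon I_1\to M$, $y_2\colon I_2\to M$ are Carathéodory solutions and $y_1(t_0)=y_2(t_0)$ with $t_0\in I_1\cap I_2$, then $y_1=y_2$ on an interval containing $t_0$ which is relatively open in $I_1\cap I_2$. * *Maximal flow*: the map $\mathrm{Fl}\colon\Omega\to M$, $\mathrm{Fl}(t,t_0,y_0)=y_{t_0,y_0}(t)$ on $\Omega=\bigcup_{(t_0,y_0)\in W}I_{t_0,y_0}\times\{(t_0,y_0)\}$,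 where $y_{t_0,y_0}\colon I_{t_0,y_0}\to M$ is the maximal solution to the initial value problem with data $(t_0,y_0)$, i.e. the solution of which each other solution is a restriction. * The equation *admits local flows which are pullbacks of $C^k$-maps* if for each $(\bar t,\bar y)\in W$ there are a relatively open interval $I\subseteq J$ containing $\bar t$, an open neighbourhood $V$ of $\bar y$ in $M$ with $I\times V\subseteq W$, and a map $\Phi\colon I\times I\times V\to M$, $\Phi_{t,t_0}(y_0):=\Phi(t,t_0,y_0)$, such that: (a) for all $(t_0,y_0)\in I\times V$, $t\mapsto\Phi_{t,t_0}(y_0)$ is a Carathéodory solution on $I$ with value $y_0$ at $t_0$; (b) there is an open neighbourhood $Y\subseteq V$ of $\bar y$ with $\Phi_{t_1,t_0}(Y)\subseteq V$ and $\Phi_{t_2,t_1}(\Phi_{t_1,t_0}(y_0))=\Phi_{t_2,t_0}(y_0)$ for all $t_0,t_1,t_2\in I$ and $y_0\in Y$; (c) there are $C^k$-manifolds $N_1,N_2$ modelled on Fréchet spaces, absolutely continuous $\zeta_j\colon I\to N_j$ for $j\in\{1,2\}$ and a $C^k$-map $\Psi\colon N_1\times N_2\times V\to M$ with $\Phi(t,t_0,y_0)=\Psi(\zeta_1(t),\zeta_2(t_0),y_0)$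 for all $(t,t_0,y_0)\in I\times I\times V$; moreover, there is a Borel set $I_0\subseteq I$ with $I\setminus I_0$ of Lebesgue measure $0$ such that $\frac{d}{dt}\Phi_{t,t_0}(y_0)$ exists and equals $f(t,\Phi_{t,t_0}(y_0))$ for all $y_0\in V$, $t_0\in I$ and $t\in I_0$. **Theorem 1.2.** Let $G$ be a Lie group modelled on a Fréchet space, with neutral element $e$ and $\mathfrak g=T_eG$; let $M$ be a smooth manifold modelled on a Fréchet space and $\sigma\colon M\times G\to M$, $(x,g)\mapsto x\cdot g$ be a smooth map which is a right $G$-action. For $v\in\mathfrak g$, let $v_\sharp(x)=T_e(\sigma(x,\cdot))(v)$ for $x\in M$ be the associated fundamental vector field. Let $a<b$ be real numbers and suppose that $\gamma\in\mathcal L^1([a,b],\mathfrak g)$ has an evolution $\eta\colon[a,b]\to G$, i.e. a Carathéodory solution on $[a,b]$ to $\dot\eta(t)=\eta(t).\gamma(t)$, $\eta(a)=e$, where $g.v=T_e\lambda_g(v)$ with $\lambda_g(h)=gh$. Then the differential equation $$\dot y(t)=\gamma(t)_\sharp(y(t))$$ on $M$ (with $J=[a,b]$ and $W=[a,b]\times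 M$) satisfies local existence and local uniqueness of Carathéodory solutions. The map $$\mathrm{Fl}\colon[a,b]\times[a,b]\times M\to M,\qquad (t,t_0,y_0)\mapsto y_0\cdot\big(\eta(t_0)^{-1}\eta(t)\big)$$ is its maximal flow; in particular, the domain of the maximal flow is all of $[a,b]\times[a,b]\times M$. Moreover, the equation admits local flows which are pullbacks of $C^\infty$-maps. -/

import Mathlib

open Set Filter Topology MeasureTheory

universe uE uG uF uM

/-! ## Fréchet spaces and Keller's `C^k`-maps -/

/-- Real Fréchet spaces: complete, metrizable (Hausdorff with countably generated uniformity),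
locally convex topological vector spaces. Since `E` is a uniform additive group, the uniformity is
the one determined by the vector space topology. -/
class IsFrechetSpace (E : Type*) [AddCommGroup E] [Module ℝ E] [UniformSpace E] : Prop extends
  IsUniformAddGroup E, ContinuousSMul ℝ E, LocallyConvexSpace ℝ E, T2Space E, CompleteSpace E,
  Filter.IsCountablyGenerated (uniformity E)

section Calculus

universe u v

/-- The directional derivative `df(x,y) = d/dt|_{t=0} f(x + t y)` exists and equals `w`. -/
def HasDirDeriv {E : Type u} {F : Type v} [AddCommGroup E] [Module ℝ E]
    [AddCommGroup F] [Module ℝ F] [TopologicalSpace F] (f : E → F) (x y : E) (w : F) : Prop :=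
  Tendsto (fun t : ℝ => t⁻¹ • (f (x + t • y) - f x)) (𝓝[≠] 0) (𝓝 w)

/-- The value `df(x,y)` of the directional derivative (meaningful where it exists). -/
noncomputable def dirDeriv {E : Type u} {F : Type v} [AddCommGroup E] [Module ℝ E]
    [AddCommGroup F] [Module ℝ F] [TopologicalSpace F] (f : E → F) (x y : E) : F :=
  limUnder (𝓝[≠] (0 : ℝ)) (fun t : ℝ => t⁻¹ • (f (x + t • y) - f x))

/-- `C^n`-maps on an open set `U ⊆ E` in Keller's `C^n_c`-theory, for `n : ℕ`: `C^0` means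
continuous; `f` is `C^{n+1}` if `f` is continuous on `U`, all directional derivatives `df(x,y)`
with `(x,y) ∈ U × E` exist, and the map `df : U × E → F` is `C^n`. -/
def IsCnOn {F : Type v} [AddCommGroup F] [Module ℝ F] [TopologicalSpace F] :
    ∀ (_n : ℕ) {E : Type u} [AddCommGroup E] [Module ℝ E] [TopologicalSpace E],
      (E → F) → Set E → Prop
  | 0, _, _, _, _, f, U => ContinuousOn f U
  | n + 1, E, _, _, _, f, U => ContinuousOn f U ∧
      ∃ df : E × E → F, (∀ x ∈ U, ∀ y : E, HasDirDeriv f x y (df (x, y))) ∧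
        IsCnOn n df (U ×ˢ (univ : Set E))

/-- `C^k`-maps on an open set `U ⊆ E`, for `k ∈ ℕ ∪ {∞}`; here `k = ⊤` means smooth. -/
def IsCkOn {E : Type u} {F : Type v} [AddCommGroup E] [Module ℝ E] [TopologicalSpace E]
    [AddCommGroup F] [Module ℝ F] [TopologicalSpace F] (k : ℕ∞) (f : E → F) (U : Set E) : Prop :=
  ∀ n : ℕ, (n : ℕ∞) ≤ k → IsCnOn n f U

end Calculus

/-! ## Fréchet manifolds, `C^k`-maps between them, and Fréchet-Lie groups -/

/-- `M`, with the given atlas, is a (Hausdorff) `C^k`-manifold modelled on the Fréchet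
space `E`. -/
structure IsFrechetManifold (k : ℕ∞) (E M : Type*) [AddCommGroup E] [Module ℝ E] [UniformSpace E]
    [TopologicalSpace M] [ChartedSpace E M] : Prop where
  frechet : IsFrechetSpace E
  hausdorff : T2Space M
  compatible : ∀ e ∈ atlas E M, ∀ e' ∈ atlas E M,
    IsCkOn k (e' ∘ e.symm) (e.target ∩ e.symm ⁻¹' e'.source)

/-- The product of two manifolds, with the products of charts as charts. -/
instance prodChartedSpaceOfModels {E F M N : Type*} [TopologicalSpace E] [TopologicalSpace F]
    [TopologicalSpace M] [TopologicalSpace N] [ChartedSpace E M] [ChartedSpace F N] :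
    ChartedSpace (E × F) (M × N) :=
  prodChartedSpace E M F N

/-- `f` is `C^k` on the open subset `S` of the manifold `M` (modelled on `E`), with values in the
manifold `N` (modelled on `F`): it is continuous and `C^k` in charts. -/
def IsCkMapOn (k : ℕ∞) (E F : Type*) {M N : Type*} [AddCommGroup E] [Module ℝ E]
    [TopologicalSpace E] [AddCommGroup F] [Module ℝ F] [TopologicalSpace F]
    [TopologicalSpace M] [ChartedSpace E M] [TopologicalSpace N] [ChartedSpace F N]
    (f : M → N) (S : Set M) : Prop :=
  ContinuousOn f S ∧ ∀ e ∈ atlas E M, ∀ e' ∈ atlas F N,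
    IsCkOn k (e' ∘ f ∘ e.symm) (e.target ∩ e.symm ⁻¹' (S ∩ f ⁻¹' e'.source))

/-- `G` is a (smooth) Lie group modelled on the Fréchet space `E`. -/
structure IsFrechetLieGroup (E G : Type*) [AddCommGroup E] [Module ℝ E] [UniformSpace E]
    [Group G] [TopologicalSpace G] [ChartedSpace E G] : Prop where
  manifold : IsFrechetManifold ⊤ E G
  smooth_mul : IsCkMapOn ⊤ (E × E) E (fun p : G × G => p.1 * p.2) univ
  smooth_inv : IsCkMapOn ⊤ E E (fun g : G => g⁻¹) univ

/-- `σ : M × G → M` is a smooth right action of `G` on `M`. -/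
structure IsSmoothRightAction (E F : Type*) {G M : Type*} [AddCommGroup E] [Module ℝ E]
    [UniformSpace E] [AddCommGroup F] [Module ℝ F] [UniformSpace F]
    [Group G] [TopologicalSpace G] [ChartedSpace E G] [TopologicalSpace M] [ChartedSpace F M]
    (σ : M × G → M) : Prop where
  act_one : ∀ x : M, σ (x, 1) = x
  act_mul : ∀ (x : M) (g h : G), σ (x, g * h) = σ (σ (x, g), h)
  smooth : IsCkMapOn ⊤ (F × E) F σ univ

/-! ## Tangent vectors -/

/-- The tangent space `T_x M` of a manifold modelled on `E`. As usual in Mathlib, it is identified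
with `E` by means of the preferred chart `φ = chartAt E x` around `x`, that is, `v ∈ E` stands for
the tangent vector `Tφ⁻¹(φ(x), v)`. -/
abbrev TangentAt (E : Type*) {M : Type*} (_x : M) : Type _ := E

/-- The tangent map `T_x f : T_x M → T_{f(x)} N`: it is the differential at `φ(x)` of `f` read in
the preferred charts `φ` around `x` and `ψ` around `f(x)`. -/
noncomputable def tangentMapAt (E F : Type*) {M N : Type*} [AddCommGroup E] [Module ℝ E]
    [TopologicalSpace E] [AddCommGroup F] [Module ℝ F] [TopologicalSpace F]
    [TopologicalSpace M] [ChartedSpace E M] [TopologicalSpace N] [ChartedSpace F N]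
    (f : M → N) (x : M) (v : TangentAt E x) : TangentAt F (f x) :=
  dirDeriv (chartAt F (f x) ∘ f ∘ (chartAt E x).symm) (chartAt E x x) v

/-- For a function `η : I → M` which is continuous at `t ∈ I`: the function is differentiable
at `t`, and its velocity there is `v ∈ T_{η(t)} M`. -/
def HasVelocityWithinAt (E : Type*) {M : Type*} [AddCommGroup E] [Module ℝ E]
    [TopologicalSpace E] [TopologicalSpace M] [ChartedSpace E M]
    (η : ℝ → M) (I : Set ℝ) (t : ℝ) (v : TangentAt E (η t)) : Prop :=
  Tendsto (slope (chartAt E (η t) ∘ η) t) (𝓝[I \ {t}] t) (𝓝 v)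

/-! ## `𝓛¹`-functions and absolutely continuous functions

Functions on a subset of `ℝ` are represented by functions on `ℝ`, of which only the values on the
subset matter. -/

/-- `γ ∈ 𝓛¹([a,b],E)`: Borel measurability, separability of the image, and finiteness of
`∫ q(γ(t)) dt` for each continuous seminorm `q`. -/
def IsL1On {E : Type*} [AddCommGroup E] [Module ℝ E] [TopologicalSpace E]
    (γ : ℝ → E) (a b : ℝ) : Prop :=
  Measurable[_, borel E] (fun t : Icc a b => γ t) ∧
  TopologicalSpace.SeparableSpace (γ '' Icc a b) ∧
  ∀ q : Seminorm ℝ E, Continuous q → ∫⁻ t in Icc a b, ENNReal.ofReal (q (γ t)) < ⊤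

/-- `w` is the weak integral `∫_a^t γ(s) ds` (for `a ≤ t`). -/
def IsWeakIntegral {E : Type*} [AddCommGroup E] [Module ℝ E] [TopologicalSpace E]
    (γ : ℝ → E) (a t : ℝ) (w : E) : Prop :=
  ∀ l : E →L[ℝ] ℝ, l w = ∫ s in Icc a t, l (γ s)

/-- `η : [a,b] → E` is absolutely continuous: `η(t) = η(a) + ∫_a^t γ(s) ds` for some
`γ ∈ 𝓛¹([a,b],E)`. -/
def IsAbsContIcc {E : Type*} [AddCommGroup E] [Module ℝ E] [TopologicalSpace E]
    (η : ℝ → E) (a b : ℝ) : Prop :=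
  ∃ γ : ℝ → E, IsL1On γ a b ∧ ∀ t ∈ Icc a b, IsWeakIntegral γ a t (η t - η a)

/-- `η : I → M` is absolutely continuous, for a manifold `M` modelled on `E` and a non-degenerate
interval `I`: it is continuous and locally absolutely continuous in charts. -/
def IsAbsContMap (E : Type*) {M : Type*} [AddCommGroup E] [Module ℝ E]
    [TopologicalSpace E] [TopologicalSpace M] [ChartedSpace E M]
    (η : ℝ → M) (I : Set ℝ) : Prop :=
  ContinuousOn η I ∧ ∀ t₀ ∈ I, ∃ φ ∈ atlas E M, ∃ α β : ℝ, α < β ∧ Icc α β ⊆ I ∧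
    Icc α β ∈ 𝓝[I] t₀ ∧ MapsTo η (Icc α β) φ.source ∧ IsAbsContIcc (φ ∘ η) α β

/-! ## Carathéodory solutions -/

/-- Non-degenerate intervals in `ℝ`. -/
def IsNondegInterval (I : Set ℝ) : Prop := I.OrdConnected ∧ I.Nontrivial

/-- `K` is relatively open in `J`. -/
def IsRelOpen (K J : Set ℝ) : Prop := ∃ O : Set ℝ, IsOpen O ∧ K = J ∩ O

section ODE

universe u v

variable {F : Type uF} {M : Type uM} [AddCommGroup F] [Module ℝ F] [UniformSpace F]
  [TopologicalSpace M] [ChartedSpace F M]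

/-- `y : I → M` is a Carathéodory solution to `ẏ(t) = f(t, y(t))`, where `f` is a time-dependent
vector field on `W ⊆ ℝ × M` (the values of `f` outside `W` are irrelevant). -/
def IsCaratheodorySol (W : Set (ℝ × M)) (f : ℝ → ∀ x : M, TangentAt F x)
    (I : Set ℝ) (y : ℝ → M) : Prop :=
  IsNondegInterval I ∧ IsAbsContMap F y I ∧ (∀ t ∈ I, (t, y t) ∈ W) ∧
    ∀ᵐ t : ℝ, t ∈ I → HasVelocityWithinAt F y I t (f t (y t))

/-- `y : I → M` is a Carathéodory solution to the initial value problem `ẏ(t) = f(t, y(t))`,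
`y(t₀) = y₀`. -/
def IsCaratheodorySolIVP (W : Set (ℝ × M)) (f : ℝ → ∀ x : M, TangentAt F x)
    (t₀ : ℝ) (y₀ : M) (I : Set ℝ) (y : ℝ → M) : Prop :=
  IsCaratheodorySol W f I y ∧ t₀ ∈ I ∧ y t₀ = y₀

/-- Local uniqueness of Carathéodory solutions. -/
def LocalUniqueness (W : Set (ℝ × M)) (f : ℝ → ∀ x : M, TangentAt F x) : Prop :=
  ∀ (I₁ I₂ : Set ℝ) (y₁ y₂ : ℝ → M),
    IsCaratheodorySol W f I₁ y₁ → IsCaratheodorySol W f I₂ y₂ →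
    ∀ t₀ ∈ I₁ ∩ I₂, y₁ t₀ = y₂ t₀ →
      ∃ K : Set ℝ, K.OrdConnected ∧ IsRelOpen K (I₁ ∩ I₂) ∧ t₀ ∈ K ∧ EqOn y₁ y₂ K

/-- Local existence of Carathéodory solutions, with respect to the interval `J` of times
(where `W ⊆ J × M`). -/
def LocalExistence (J : Set ℝ) (W : Set (ℝ × M)) (f : ℝ → ∀ x : M, TangentAt F x) : Prop :=
  ∀ p ∈ W, ∃ (I : Set ℝ) (y : ℝ → M), IsRelOpen I J ∧ IsCaratheodorySolIVP W f p.1 p.2 I y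

/-- `y : I → M` is the maximal solution to the initial value problem: every solution is a
restriction of it. -/
def IsMaximalSol (W : Set (ℝ × M)) (f : ℝ → ∀ x : M, TangentAt F x)
    (t₀ : ℝ) (y₀ : M) (I : Set ℝ) (y : ℝ → M) : Prop :=
  IsCaratheodorySolIVP W f t₀ y₀ I y ∧
    ∀ (I' : Set ℝ) (y' : ℝ → M), IsCaratheodorySolIVP W f t₀ y₀ I' y' → I' ⊆ I ∧ EqOn y' y I'

/-- `Fl : Ω → M` is the maximal flow of `ẏ(t) = f(t, y(t))`: the set `Ω` is the union of the
sets `I × {(t₀,y₀)}` for `(t₀,y₀) ∈ W`, where `I` is the domain of the maximal solution to the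
initial value problem `y(t₀) = y₀`, and `Fl(·, t₀, y₀)` is that solution. -/
def IsMaximalFlow (W : Set (ℝ × M)) (f : ℝ → ∀ x : M, TangentAt F x)
    (Ω : Set (ℝ × ℝ × M)) (Fl : ℝ × ℝ × M → M) : Prop :=
  (∀ p ∈ Ω, p.2 ∈ W) ∧
  ∀ (t₀ : ℝ) (y₀ : M), (t₀, y₀) ∈ W →
    IsMaximalSol W f t₀ y₀ {t | (t, t₀, y₀) ∈ Ω} (fun t => Fl (t, t₀, y₀))

/-- The differential equation `ẏ(t) = f(t, y(t))` on `W ⊆ J × M` admits local flows which are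
pullbacks of `C^k`-maps. -/
def AdmitsLocalFlows (k : ℕ∞) (J : Set ℝ) (W : Set (ℝ × M))
    (f : ℝ → ∀ x : M, TangentAt F x) : Prop :=
  ∀ p ∈ W, ∃ (I : Set ℝ) (V : Set M) (Φ : ℝ → ℝ → M → M),
    I.OrdConnected ∧ IsRelOpen I J ∧ p.1 ∈ I ∧ IsOpen V ∧ p.2 ∈ V ∧ I ×ˢ V ⊆ W ∧
    -- solution property
    (∀ t₀ ∈ I, ∀ y₀ ∈ V, IsCaratheodorySolIVP W f t₀ y₀ I (fun t => Φ t t₀ y₀)) ∧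
    -- flow property
    (∃ Y : Set M, IsOpen Y ∧ p.2 ∈ Y ∧ Y ⊆ V ∧
      (∀ t₀ ∈ I, ∀ t₁ ∈ I, MapsTo (Φ t₁ t₀) Y V) ∧
      ∀ t₀ ∈ I, ∀ t₁ ∈ I, ∀ t₂ ∈ I, ∀ y₀ ∈ Y, Φ t₂ t₁ (Φ t₁ t₀ y₀) = Φ t₂ t₀ y₀) ∧
    -- pullback of a `C^k`-map
    (∃ (E₁ : Type u) (_ : AddCommGroup E₁) (_ : Module ℝ E₁) (_ : UniformSpace E₁)
       (N₁ : Type v) (_ : TopologicalSpace N₁) (_ : ChartedSpace E₁ N₁)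
       (E₂ : Type u) (_ : AddCommGroup E₂) (_ : Module ℝ E₂) (_ : UniformSpace E₂)
       (N₂ : Type v) (_ : TopologicalSpace N₂) (_ : ChartedSpace E₂ N₂)
       (ζ₁ : ℝ → N₁) (ζ₂ : ℝ → N₂) (Ψ : N₁ × N₂ × M → M),
      IsFrechetManifold k E₁ N₁ ∧ IsFrechetManifold k E₂ N₂ ∧
      IsAbsContMap E₁ ζ₁ I ∧ IsAbsContMap E₂ ζ₂ I ∧
      IsCkMapOn k (E₁ × E₂ × F) F Ψ (univ ×ˢ univ ×ˢ V) ∧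
      ∀ t ∈ I, ∀ t₀ ∈ I, ∀ y₀ ∈ V, Φ t t₀ y₀ = Ψ (ζ₁ t, ζ₂ t₀, y₀)) ∧
    -- a common set of times of full measure at which all curves solve the equation
    (∃ I₀ : Set ℝ, I₀ ⊆ I ∧ MeasurableSet I₀ ∧ volume (I \ I₀) = 0 ∧
      ∀ y₀ ∈ V, ∀ t₀ ∈ I, ∀ t ∈ I₀,
        HasVelocityWithinAt F (fun s => Φ s t₀ y₀) I t (f t (Φ t t₀ y₀)))

end ODE

/-! ## Evolutions and fundamental vector fields -/

/-- `η : [a,b] → G` is the evolution of `γ : [a,b] → 𝔤 = T_e G`: the Carathéodory solution to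
`ẏ(t) = y(t).γ(t)`, `y(a) = e`, where `g.v = T_e λ_g (v)` with the left translation
`λ_g(h) = g h`. -/
def IsEvolution (E : Type*) {G : Type*} [AddCommGroup E] [Module ℝ E] [UniformSpace E]
    [Group G] [TopologicalSpace G] [ChartedSpace E G]
    (a b : ℝ) (γ : ℝ → TangentAt E (1 : G)) (η : ℝ → G) : Prop :=
  IsCaratheodorySolIVP (F := E) (Icc a b ×ˢ (univ : Set G))
    (fun t g => tangentMapAt E E (fun h : G => g * h) 1 (γ t)) a 1 (Icc a b) η

/-- The fundamental vector field `v_♯(x) = T_e(σ(x,·))(v)` of `v ∈ 𝔤 = T_e G`; note that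
`σ(x,e) = x`. -/
noncomputable def fundamentalVectorField (E F : Type*) {G M : Type*} [AddCommGroup E] [Module ℝ E]
    [UniformSpace E] [AddCommGroup F] [Module ℝ F] [UniformSpace F]
    [Group G] [TopologicalSpace G] [ChartedSpace E G] [TopologicalSpace M] [ChartedSpace F M]
    (σ : M × G → M) (v : TangentAt E (1 : G)) (x : M) : TangentAt F x :=
  tangentMapAt E F (fun g : G => σ (x, g)) 1 v

/-! Uniqueness and the flow formula both come from an invariant: if `y` solves the equation, then
`z(t) = y(t).η(t)⁻¹` is constant. Indeed, the smooth map `(x,g) ↦ x.g⁻¹` kills the pairs `(v_♯(x),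
g.v)`: if the curve `h` represents `v`, then `(x.h(s), g h(s))` is sent to the constant point
`x.g⁻¹` (`IsSmoothRightAction.tangentMapAt_act_inv`). Hence `z` has velocity zero almost everywhere,
and `y(t) = y(s).(η(s)⁻¹η(t))` (`IsEvolution.eq_of_isCaratheodorySol`). Conversely `g ↦ x.(k g)`
carries `g.v` to `v_♯(x.(k g))`, so these curves are solutions. No Picard-Lindelöf or Gronwall
argument is involved.

The analytic work is to justify this for absolutely continuous curves in Fréchet manifolds. Two
facts are needed: smooth maps preserve absolute continuity (`IsAbsContIcc.comp_isCnOn`), and an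
absolutely continuous curve with velocity zero almost everywhere is constant
(`IsAbsContMap.eq_of_ae_velocity_zero`). Weak integrals are tested by functionals, so the first fact
reduces to a fundamental theorem of calculus for real-valued `C²`-maps
(`sub_eq_integral_differential`). There the differential is locally Lipschitz for one continuous
seminorm `p`, and increments of the defect are compared with `ε ∫ p(γ)`. The second fact reduces to
Lebesgue differentiation of a scalar function. -/

/-! ### Directional derivatives and the mean value theorem -/

section DirectionalDerivatives

variable {E : Type*} [AddCommGroup E] [Module ℝ E]
  {F : Type*} [AddCommGroup F] [Module ℝ F] [TopologicalSpace F]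

theorem HasDirDeriv.unique [T2Space F] {f : E → F} {x y : E} {w w' : F}
    (h : HasDirDeriv f x y w) (h' : HasDirDeriv f x y w') : w = w' :=
  tendsto_nhds_unique h h'

theorem HasDirDeriv.dirDeriv_eq [T2Space F] {f : E → F} {x y : E} {w : F}
    (h : HasDirDeriv f x y w) : dirDeriv f x y = w :=
  h.limUnder_eq

theorem HasDirDeriv.const_smul [ContinuousSMul ℝ F] {f : E → F} {x y : E} {w : F}
    (h : HasDirDeriv f x y w) (c : ℝ) : HasDirDeriv (fun z => c • f z) x y (c • w) := by
  refine (Tendsto.const_smul h c).congr fun t => ?_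
  rw [← smul_sub, smul_comm]

theorem HasDirDeriv.smul [ContinuousSMul ℝ F] {f : E → F} {x y : E} {w : F}
    (h : HasDirDeriv f x y w) (c : ℝ) : HasDirDeriv f x (c • y) (c • w) := by
  rcases eq_or_ne c 0 with rfl | hc
  · simp only [HasDirDeriv, zero_smul, smul_zero, add_zero, sub_self]
    exact tendsto_const_nhds
  have hlim : Tendsto (fun t : ℝ => t * c) (𝓝[≠] 0) (𝓝[≠] 0) := by
    refine tendsto_nhdsWithin_of_tendsto_nhds_of_eventually_within _ ?_ ?_
    · have : Tendsto (fun t : ℝ => t * c) (𝓝 0) (𝓝 (0 * c)) := by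
        exact (continuous_id.mul continuous_const).tendsto 0
      rw [zero_mul] at this
      exact this.mono_left nhdsWithin_le_nhds
    · filter_upwards [self_mem_nhdsWithin] with t ht
      exact mul_ne_zero ht hc
  refine ((h.comp hlim).const_smul c).congr fun t => ?_
  rw [Function.comp_apply, mul_smul, smul_smul, mul_inv, mul_comm t⁻¹ c⁻¹, ← mul_assoc,
    mul_inv_cancel₀ hc, one_mul]

theorem map_smul_of_hasDirDeriv [ContinuousSMul ℝ F] [T2Space F] {f : E → F} {df : E × E → F}
    {U : Set E} (hdf : ∀ x ∈ U, ∀ y : E, HasDirDeriv f x y (df (x, y))) {x : E} (hx : x ∈ U)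
    (c : ℝ) (v : E) : df (x, c • v) = c • df (x, v) :=
  (hdf x hx (c • v)).unique ((hdf x hx v).smul c)

theorem HasDirDeriv.congr_of_isOpen [TopologicalSpace E] [ContinuousAdd E] [ContinuousSMul ℝ E]
    {f g : E → F} {U : Set E} (hU : IsOpen U) (hfg : EqOn f g U) {x y : E} (hx : x ∈ U) {w : F}
    (h : HasDirDeriv f x y w) : HasDirDeriv g x y w := by
  refine Tendsto.congr' ?_ h
  have hc : Tendsto (fun t : ℝ => x + t • y) (𝓝 0) (𝓝 x) := by
    have : Continuous fun t : ℝ => x + t • y := by fun_prop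
    simpa using this.tendsto 0
  filter_upwards [(hc.mono_left nhdsWithin_le_nhds).eventually (hU.mem_nhds hx)] with t ht
  rw [hfg ht, hfg hx]

/-- Mean value theorem: if all directional derivatives along a segment lie in a closed convex set,
then so does the increment. -/
theorem sub_mem_of_forall_hasDirDeriv_mem [IsTopologicalAddGroup F] [ContinuousSMul ℝ F]
    [LocallyConvexSpace ℝ F] {f : E → F} {x v : E} {d : ℝ → F} {C : Set F}
    (hC : Convex ℝ C) (hCc : IsClosed C)
    (hd : ∀ s ∈ Icc (0 : ℝ) 1, HasDirDeriv f (x + s • v) v (d s))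
    (hdC : ∀ s ∈ Icc (0 : ℝ) 1, d s ∈ C) : f (x + v) - f x ∈ C := by
  by_contra hmem
  -- A functional separating the increment from `C` contradicts the scalar mean value theorem for `s
  -- ↦ l (f (x + s • v))`.
  obtain ⟨l, u, hlt, hul⟩ := geometric_hahn_banach_closed_point hC hCc hmem
  have hder : ∀ s ∈ Icc (0 : ℝ) 1, HasDerivAt (fun s : ℝ => l (f (x + s • v))) (l (d s)) s := by
    intro s hs
    rw [hasDerivAt_iff_tendsto_slope_zero]
    refine ((l.continuous.tendsto _).comp (hd s hs)).congr fun t => ?_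
    simp only [Function.comp_apply, map_smul, map_sub, add_smul, add_assoc]
  obtain ⟨c, hc, hceq⟩ := exists_hasDerivAt_eq_slope (fun s : ℝ => l (f (x + s • v)))
    (fun s => l (d s)) one_pos (fun s hs => (hder s hs).continuousAt.continuousWithinAt)
    (fun s hs => hder s (Ioo_subset_Icc_self hs))
  have h1 := hlt _ (hdC c (Ioo_subset_Icc_self hc))
  simp only [one_smul, zero_smul, add_zero, sub_zero, div_one] at hceq
  rw [hceq, ← map_sub] at h1
  exact lt_asymm h1 hul

/-- Provides the closed convex sets to which the mean value theorem applies: the closure of a convex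
neighbourhood lying in a closed one. -/
theorem exists_isClosed_convex_nhds [IsTopologicalAddGroup F] [ContinuousSMul ℝ F]
    [LocallyConvexSpace ℝ F] {w : F} {N : Set F} (hN : N ∈ 𝓝 w) :
    ∃ C ∈ 𝓝 w, IsClosed C ∧ Convex ℝ C ∧ C ⊆ N := by
  obtain ⟨K, ⟨hK, hKc⟩, hKN⟩ := (closed_nhds_basis w).mem_iff.1 hN
  obtain ⟨D, ⟨hD, hDc⟩, hDK⟩ := (LocallyConvexSpace.convex_basis (𝕜 := ℝ) w).mem_iff.1 hK
  exact ⟨closure D, mem_of_superset hD subset_closure, isClosed_closure, hDc.closure,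
    (closure_minimal hDK hKc).trans hKN⟩

end DirectionalDerivatives

/-! ### Uniform difference quotients and linearity of the differential -/

section StrictDifferentiability

variable {E : Type*} [AddCommGroup E] [Module ℝ E] [TopologicalSpace E] [IsTopologicalAddGroup E]
  [ContinuousSMul ℝ E]
  {F : Type*} [AddCommGroup F] [Module ℝ F] [TopologicalSpace F] [IsTopologicalAddGroup F]
  [ContinuousSMul ℝ F] [LocallyConvexSpace ℝ F]
  {f : E → F} {df : E × E → F} {U : Set E}

/-- The difference quotients of a `C¹`-map converge to the directional derivative, uniformly in
the base point and in the direction. -/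
theorem tendsto_differenceQuotient (hU : IsOpen U)
    (hdf : ∀ x ∈ U, ∀ y : E, HasDirDeriv f x y (df (x, y)))
    (hc : ContinuousOn df (U ×ˢ univ)) {x : E} (hx : x ∈ U) (v : E) :
    Tendsto (fun p : ℝ × E × E => p.1⁻¹ • (f (p.2.1 + p.1 • p.2.2) - f p.2.1))
      (𝓝[≠] 0 ×ˢ 𝓝 (x, v)) (𝓝 (df (x, v))) := by
  rw [Filter.tendsto_def]
  intro N hN
  obtain ⟨C, hC, hCc, hCconv, hCN⟩ := exists_isClosed_convex_nhds hN
  have hUo : IsOpen (U ×ˢ (univ : Set E)) := hU.prod isOpen_univ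
  have hxv : (x, v) ∈ U ×ˢ (univ : Set E) := ⟨hx, mem_univ _⟩
  have h1 : ∀ᶠ q in 𝓝 (x, v), df q ∈ C ∧ q.1 ∈ U := by
    have ha := (hc.continuousAt (hUo.mem_nhds hxv)).eventually hC
    filter_upwards [ha, hUo.mem_nhds hxv] with q hq hq' using ⟨hq, hq'.1⟩
  have h2 : ∀ᶠ p : ℝ × E × E in 𝓝 (0, x, v), ∀ s ∈ Icc (0 : ℝ) 1,
      df (p.2.1 + s • (p.1 • p.2.2), p.2.2) ∈ C ∧ p.2.1 + s • (p.1 • p.2.2) ∈ U := by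
    -- Tube lemma: as the step size vanishes, the whole segment stays in the region where `df` takes
    -- values in `C`.
    refine isCompact_Icc.eventually_forall_of_forall_eventually fun s _ => ?_
    have hcont : Continuous fun z : (ℝ × E × E) × ℝ =>
        (z.1.2.1 + z.2 • (z.1.1 • z.1.2.2), z.1.2.2) := by fun_prop
    have := hcont.tendsto ((0, x, v), s)
    simp only [zero_smul, smul_zero, add_zero] at this
    exact this.eventually h1
  have h3 : (𝓝[≠] (0 : ℝ) ×ˢ 𝓝 (x, v)) ≤ 𝓝 ((0 : ℝ), x, v) := by
    rw [nhds_prod_eq (x := (0 : ℝ))]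
    exact prod_mono nhdsWithin_le_nhds le_rfl
  have h4 : ∀ᶠ p : ℝ × E × E in 𝓝[≠] (0 : ℝ) ×ˢ 𝓝 (x, v), p.1 ≠ 0 :=
    tendsto_fst.eventually self_mem_nhdsWithin
  filter_upwards [h3 h2, h4] with p hp hp0
  refine hCN ?_
  change p.1⁻¹ • (f (p.2.1 + p.1 • p.2.2) - f p.2.1) ∈ C
  rw [smul_sub]
  refine sub_mem_of_forall_hasDirDeriv_mem (f := fun z => p.1⁻¹ • f z)
    (d := fun s => df (p.2.1 + s • (p.1 • p.2.2), p.2.2)) hCconv hCc (fun s hs => ?_)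
    (fun s hs => (hp s hs).1)
  have := ((hdf _ (hp s hs).2 p.2.2).smul p.1).const_smul p.1⁻¹
  rwa [inv_smul_smul₀ hp0] at this

/-- Chain rule along a filter: if a family of points `c i` approaches `x` with velocity `v`, then
`f (c i)` approaches `f x` with velocity `df (x, v)`. -/
theorem tendsto_differenceQuotient_comp (hU : IsOpen U)
    (hdf : ∀ x ∈ U, ∀ y : E, HasDirDeriv f x y (df (x, y)))
    (hc : ContinuousOn df (U ×ˢ univ)) {x : E} (hx : x ∈ U) {v : E} {ι : Type*} {L : Filter ι}
    {h : ι → ℝ} {c : ι → E} (hh : Tendsto h L (𝓝[≠] 0))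
    (hcv : Tendsto (fun i => (h i)⁻¹ • (c i - x)) L (𝓝 v)) :
    Tendsto (fun i => (h i)⁻¹ • (f (c i) - f x)) L (𝓝 (df (x, v))) := by
  -- Here `c i = x + h i • w i` with `w i = (h i)⁻¹ • (c i - x) → v`; the direction varies, so the
  -- uniform limit is needed.
  have := (tendsto_differenceQuotient hU hdf hc hx v).comp
    (hh.prodMk ((tendsto_const_nhds (x := x)).prodMk_nhds hcv))
  refine this.congr' ?_
  filter_upwards [hh.eventually self_mem_nhdsWithin] with i hi
  have hi : h i ≠ 0 := hi
  simp only [Function.comp_apply, smul_smul, mul_inv_cancel₀ hi, one_smul, add_sub_cancel]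

/-- The quotient in direction `u + v` is the quotient in direction `u` at `x` plus the one in
direction `v` at the moving point `x + t • u`; uniformity in the base point gives the limit of the
latter. -/
theorem map_add_of_hasDirDeriv [T2Space F] (hU : IsOpen U)
    (hdf : ∀ x ∈ U, ∀ y : E, HasDirDeriv f x y (df (x, y)))
    (hc : ContinuousOn df (U ×ˢ univ)) {x : E} (hx : x ∈ U) (u v : E) :
    df (x, u + v) = df (x, u) + df (x, v) := by
  have h1 : Tendsto (fun t : ℝ => x + t • u) (𝓝[≠] 0) (𝓝 x) := by
    have : Continuous fun t : ℝ => x + t • u := by fun_prop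
    have := this.tendsto 0
    simp only [zero_smul, add_zero] at this
    exact this.mono_left nhdsWithin_le_nhds
  have h2 := (tendsto_differenceQuotient hU hdf hc hx v).comp
    (tendsto_id.prodMk (h1.prodMk_nhds (tendsto_const_nhds (x := v))))
  refine (hdf x hx (u + v)).unique (((hdf x hx u).add h2).congr fun t => ?_)
  simp only [Function.comp_apply, id, ← smul_add, add_assoc]
  congr 1
  abel

/-- The differential at a point, as a continuous linear map. -/
def differentialCLM [T2Space F] (hU : IsOpen U)
    (hdf : ∀ x ∈ U, ∀ y : E, HasDirDeriv f x y (df (x, y)))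
    (hc : ContinuousOn df (U ×ˢ univ)) {x : E} (hx : x ∈ U) : E →L[ℝ] F where
  toFun v := df (x, v)
  map_add' := map_add_of_hasDirDeriv hU hdf hc hx
  map_smul' := map_smul_of_hasDirDeriv hdf hx
  cont := by
    rw [← continuousOn_univ]
    exact hc.comp (Continuous.continuousOn (by fun_prop)) fun v _ => ⟨hx, mem_univ v⟩

end StrictDifferentiability

/-! ### Calculus of Keller `Cⁿ`-maps -/

section IsCnOn

universe u v w

theorem IsCnOn.continuousOn {F : Type v} [AddCommGroup F] [Module ℝ F] [TopologicalSpace F]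
    {n : ℕ} {E : Type u} [AddCommGroup E] [Module ℝ E] [TopologicalSpace E] {f : E → F} {U : Set E}
    (h : IsCnOn n f U) : ContinuousOn f U := by
  cases n with
  | zero => exact h
  | succ n => exact h.1

/-- The domain is quantified inside the induction on `n`, because passing from `f` to `df` replaces
`E` by `E × E`. -/
theorem IsCnOn.mono {F : Type v} [AddCommGroup F] [Module ℝ F] [TopologicalSpace F] {n : ℕ} :
    ∀ {E : Type u} [AddCommGroup E] [Module ℝ E] [TopologicalSpace E] {f : E → F} {U V : Set E},
      IsCnOn n f U → V ⊆ U → IsCnOn n f V := by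
  induction n with
  | zero => intro E _ _ _ f U V h hVU; exact ContinuousOn.mono h hVU
  | succ n ih =>
    rintro E _ _ _ f U V ⟨hf, df, hdf, hn⟩ hVU
    exact ⟨hf.mono hVU, df, fun x hx => hdf x (hVU hx), ih hn (prod_mono hVU subset_rfl)⟩

theorem IsCnOn.of_succ {F : Type v} [AddCommGroup F] [Module ℝ F] [TopologicalSpace F] {n : ℕ} :
    ∀ {E : Type u} [AddCommGroup E] [Module ℝ E] [TopologicalSpace E] {f : E → F} {U : Set E},
      IsCnOn (n + 1) f U → IsCnOn n f U := by
  induction n with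
  | zero => intro E _ _ _ f U h; exact h.1
  | succ n ih =>
    rintro E _ _ _ f U ⟨hf, df, hdf, hn⟩
    exact ⟨hf, df, hdf, ih hn⟩

theorem IsCnOn.congr {F : Type v} [AddCommGroup F] [Module ℝ F] [TopologicalSpace F] {n : ℕ}
    {E : Type u} [AddCommGroup E] [Module ℝ E] [TopologicalSpace E] [IsTopologicalAddGroup E]
    [ContinuousSMul ℝ E] {f g : E → F} {U : Set E} (hU : IsOpen U)
    (h : IsCnOn n f U) (hfg : EqOn f g U) : IsCnOn n g U := by
  cases n with
  | zero => exact ContinuousOn.congr h hfg.symm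
  | succ n =>
    obtain ⟨hf, df, hdf, hn⟩ := h
    exact ⟨hf.congr hfg.symm, df, fun x hx y => (hdf x hx y).congr_of_isOpen hU hfg hx, hn⟩

theorem IsCnOn.of_locally {F : Type v} [AddCommGroup F] [Module ℝ F] [TopologicalSpace F]
    [T2Space F] {n : ℕ} :
    ∀ {E : Type u} [AddCommGroup E] [Module ℝ E] [TopologicalSpace E] [IsTopologicalAddGroup E]
      [ContinuousSMul ℝ E] {f : E → F} {U : Set E},
      (∀ x ∈ U, ∃ V : Set E, IsOpen V ∧ x ∈ V ∧ IsCnOn n f V) → IsCnOn n f U := by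
  induction n with
  | zero =>
    intro E _ _ _ _ _ f U h x hx
    obtain ⟨V, hV, hxV, hf⟩ := h x hx
    exact (ContinuousOn.continuousAt hf (hV.mem_nhds hxV)).continuousWithinAt
  | succ n ih =>
    intro E _ _ _ _ _ f U h
    -- The local differentials are glued through the canonical value `dirDeriv`, with which each
    -- agrees by uniqueness of limits.
    refine ⟨fun x hx => ?_, fun p => dirDeriv f p.1 p.2, fun x hx y => ?_, ih ?_⟩
    · obtain ⟨V, hV, hxV, hf⟩ := h x hx
      exact (hf.continuousOn.continuousAt (hV.mem_nhds hxV)).continuousWithinAt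
    · obtain ⟨V, hV, hxV, hf, df, hdf, hn⟩ := h x hx
      change HasDirDeriv f x y (dirDeriv f x y)
      rw [(hdf x hxV y).dirDeriv_eq]
      exact hdf x hxV y
    · rintro ⟨x, y⟩ ⟨hx, -⟩
      obtain ⟨V, hV, hxV, hf, df, hdf, hn⟩ := h x hx
      refine ⟨V ×ˢ univ, hV.prod isOpen_univ, ⟨hxV, mem_univ _⟩,
        hn.congr (hV.prod isOpen_univ) ?_⟩
      rintro ⟨x', y'⟩ ⟨hx', -⟩
      exact (hdf x' hx' y').dirDeriv_eq.symm

theorem IsCnOn.const {F : Type v} [AddCommGroup F] [Module ℝ F] [TopologicalSpace F] {n : ℕ} :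
    ∀ {E : Type u} [AddCommGroup E] [Module ℝ E] [TopologicalSpace E] (c : F) (U : Set E),
      IsCnOn n (fun _ : E => c) U := by
  induction n with
  | zero => intro E _ _ _ c U; exact continuousOn_const
  | succ n ih =>
    intro E _ _ _ c U
    refine ⟨continuousOn_const, fun _ => 0, fun x _ y => ?_, ih _ _⟩
    simp only [HasDirDeriv, sub_self, smul_zero]
    exact tendsto_const_nhds

theorem ContinuousLinearMap.isCnOn {F : Type v} [AddCommGroup F] [Module ℝ F] [TopologicalSpace F]
    {n : ℕ} : ∀ {E : Type u} [AddCommGroup E] [Module ℝ E] [TopologicalSpace E] (L : E →L[ℝ] F)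
      (U : Set E), IsCnOn n L U := by
  induction n with
  | zero => intro E _ _ _ L U; exact L.continuous.continuousOn
  | succ n ih =>
    intro E _ _ _ L U
    refine ⟨L.continuous.continuousOn, L.comp (ContinuousLinearMap.snd ℝ E E), fun x _ y => ?_,
      ih _ _⟩
    refine tendsto_const_nhds.congr' ?_
    filter_upwards [self_mem_nhdsWithin] with t ht
    have ht : t ≠ 0 := ht
    simp [smul_smul, inv_mul_cancel₀ ht]

theorem IsCnOn.prodMk {F : Type v} [AddCommGroup F] [Module ℝ F] [TopologicalSpace F]
    {H : Type w} [AddCommGroup H] [Module ℝ H] [TopologicalSpace H] {n : ℕ} :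
    ∀ {E : Type u} [AddCommGroup E] [Module ℝ E] [TopologicalSpace E] {f : E → F} {g : E → H}
      {U : Set E}, IsCnOn n f U → IsCnOn n g U → IsCnOn n (fun x => (f x, g x)) U := by
  induction n with
  | zero => intro E _ _ _ f g U hf hg; exact ContinuousOn.prodMk hf hg
  | succ n ih =>
    rintro E _ _ _ f g U ⟨hf, df, hdf, hn⟩ ⟨hg, dg, hdg, hm⟩
    exact ⟨hf.prodMk hg, fun p => (df p, dg p),
      fun x hx y => (hdf x hx y).prodMk_nhds (hdg x hx y), ih hn hm⟩

theorem IsCnOn.comp_continuousLinearMap {F : Type v} [AddCommGroup F] [Module ℝ F]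
    [TopologicalSpace F] {n : ℕ} :
    ∀ {E E' : Type u} [AddCommGroup E] [Module ℝ E] [TopologicalSpace E]
      [AddCommGroup E'] [Module ℝ E'] [TopologicalSpace E'] {f : E → F} {U : Set E'} {V : Set E},
      IsCnOn n f V → ∀ L : E' →L[ℝ] E, MapsTo L U V → IsCnOn n (f ∘ L) U := by
  induction n with
  | zero =>
    intro E E' _ _ _ _ _ _ f U V hf L hm
    exact ContinuousOn.comp hf L.continuous.continuousOn hm
  | succ n ih =>
    rintro E E' _ _ _ _ _ _ f U V ⟨hf, df, hdf, hn⟩ L hm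
    refine ⟨hf.comp L.continuous.continuousOn hm, df ∘ (L.prodMap L), fun x hx y => ?_,
      ih hn _ fun p hp => ⟨hm hp.1, mem_univ _⟩⟩
    have := hdf (L x) (hm hx) (L y)
    simp only [HasDirDeriv] at this ⊢
    simpa using this

/-- Compositions of Keller `Cⁿ`-maps are `Cⁿ`. -/
theorem IsCnOn.comp {H : Type w} [AddCommGroup H] [Module ℝ H] [TopologicalSpace H]
    [IsTopologicalAddGroup H] [ContinuousSMul ℝ H] [LocallyConvexSpace ℝ H] {n : ℕ} :
    ∀ {E : Type u} [AddCommGroup E] [Module ℝ E] [TopologicalSpace E]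
      {F : Type v} [AddCommGroup F] [Module ℝ F] [TopologicalSpace F] [IsTopologicalAddGroup F]
      [ContinuousSMul ℝ F] {g : F → H} {f : E → F} {U : Set E} {V : Set F},
      IsOpen V → IsCnOn n g V → IsCnOn n f U → MapsTo f U V → IsCnOn n (g ∘ f) U := by
  induction n with
  | zero => intro E _ _ _ F _ _ _ _ _ g f U V _ hg hf hm; exact ContinuousOn.comp hg hf hm
  | succ n ih =>
    rintro E _ _ _ F _ _ _ _ _ g f U V hV ⟨hg, dg, hdg, hgn⟩ hf' hm
    obtain ⟨hf, df, hdf, hfn⟩ := hf'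
    have hfn' : IsCnOn n f U := IsCnOn.of_succ ⟨hf, df, hdf, hfn⟩
    -- Chain rule `d(g ∘ f)(x,y) = dg(f x, df(x,y))`: again a composition of `Cⁿ`-maps, so the
    -- induction closes.
    refine ⟨hg.comp hf hm, dg ∘ fun p : E × E => (f p.1, df p), fun x hx y => ?_, ?_⟩
    · exact tendsto_differenceQuotient_comp hV hdg hgn.continuousOn (hm hx) tendsto_id (hdf x hx y)
    · refine ih (hV.prod isOpen_univ) hgn (IsCnOn.prodMk ?_ hfn)
        fun p hp => ⟨hm hp.1, mem_univ _⟩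
      exact hfn'.comp_continuousLinearMap (ContinuousLinearMap.fst ℝ E E) fun p hp => hp.1

end IsCnOn

/-! ### Products of Fréchet spaces and seminorm estimates -/

instance IsFrechetSpace.prod {E F : Type*} [AddCommGroup E] [Module ℝ E] [UniformSpace E]
    [IsFrechetSpace E] [AddCommGroup F] [Module ℝ F] [UniformSpace F] [IsFrechetSpace F] :
    IsFrechetSpace (E × F) where

instance Real.isFrechetSpace : IsFrechetSpace ℝ where

section Seminorms

/-- Homogeneity; since `p v` may vanish, `v` is rescaled by `(p v + ε)⁻¹` and then `ε → 0`. -/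
theorem le_mul_seminorm_of_forall_lt_one {E : Type*} [AddCommGroup E] [Module ℝ E]
    (p : Seminorm ℝ E) {N : E → ℝ} {C : ℝ}
    (hN : ∀ (c : ℝ) v, 0 < c → N (c • v) = c * N v) (h : ∀ v, p v < 1 → N v ≤ C) (v : E) :
    N v ≤ C * p v := by
  have key : ∀ ε > 0, N v ≤ C * (p v + ε) := by
    intro ε hε
    have hpos : 0 < p v + ε := add_pos_of_nonneg_of_pos (apply_nonneg p v) hε
    have h1 := h ((p v + ε)⁻¹ • v) (by
      rw [map_smul_eq_mul, Real.norm_of_nonneg (inv_nonneg.2 hpos.le), inv_mul_lt_iff₀ hpos]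
      linarith)
    rw [hN _ _ (inv_pos.2 hpos), inv_mul_le_iff₀ hpos] at h1
    linarith
  have hlim : Tendsto (fun ε : ℝ => C * (p v + ε)) (𝓝[>] 0) (𝓝 (C * (p v + 0))) := by
    have : Continuous fun ε : ℝ => C * (p v + ε) := by fun_prop
    exact (this.tendsto 0).mono_left nhdsWithin_le_nhds
  rw [add_zero] at hlim
  refine ge_of_tendsto hlim ?_
  filter_upwards [self_mem_nhdsWithin] with ε hε using key ε hε

variable {E : Type*} [AddCommGroup E] [Module ℝ E] [TopologicalSpace E] [IsTopologicalAddGroup E]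
  [ContinuousSMul ℝ E] [LocallyConvexSpace ℝ E]

theorem exists_continuous_seminorm_ball_subset {N : Set E} (hN : N ∈ 𝓝 (0 : E)) :
    ∃ p : Seminorm ℝ E, Continuous p ∧ ∀ v, p v < 1 → v ∈ N := by
  obtain ⟨s, ⟨h0, hs, hsc⟩, hsN⟩ := (nhds_hasBasis_absConvex_open ℝ E).mem_iff.1 hN
  refine ⟨gaugeSeminormFamily ℝ E ⟨s, h0, hs, hsc⟩,
    (with_gaugeSeminormFamily (𝕜 := ℝ) (E := E)).continuous_seminorm _, fun v hv => hsN ?_⟩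
  have := gaugeSeminormFamily_ball (𝕜 := ℝ) (E := E) ⟨s, h0, hs, hsc⟩
  have hv' : v ∈ (gaugeSeminormFamily ℝ E ⟨s, h0, hs, hsc⟩).ball 0 1 := by
    simpa [Seminorm.mem_ball] using hv
  rw [this] at hv'
  exact hv'

end Seminorms

/-! ### Local seminorm bounds on differentials -/

section DifferentialBounds

variable {E : Type*} [AddCommGroup E] [Module ℝ E] [TopologicalSpace E] [IsTopologicalAddGroup E]
  [ContinuousSMul ℝ E] [LocallyConvexSpace ℝ E]
  {F : Type*} [AddCommGroup F] [Module ℝ F] [TopologicalSpace F]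
  [ContinuousSMul ℝ F] [T2Space F]

/-- Since `df (x, 0) = 0`, continuity gives `q (df (z, v)) < 1` for `z` near `x` and `v` near `0`;
homogeneity in `v` extends this to all directions, with one seminorm for all such `z`. -/
theorem exists_seminorm_bound_differential {f : E → F} {df : E × E → F} {U : Set E}
    (hU : IsOpen U) (hdf : ∀ x ∈ U, ∀ y : E, HasDirDeriv f x y (df (x, y)))
    (hc : ContinuousOn df (U ×ˢ univ)) {x : E} (hx : x ∈ U) {q : Seminorm ℝ F}
    (hq : Continuous q) :
    ∃ p : Seminorm ℝ E, Continuous p ∧ ∀ᶠ z in 𝓝 x, ∀ v, q (df (z, v)) ≤ p v := by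
  have hUo : IsOpen (U ×ˢ (univ : Set E)) := hU.prod isOpen_univ
  have h0 : df (x, 0) = 0 := by
    simpa using map_smul_of_hasDirDeriv hdf hx 0 0
  have h1 : ∀ᶠ z : E × E in 𝓝 (x, 0), q (df z) < 1 := by
    have h2 := (hq.continuousAt.comp
      (hc.continuousAt (hUo.mem_nhds (⟨hx, mem_univ _⟩ : (x, (0 : E)) ∈ U ×ˢ univ))))
    refine h2.eventually (gt_mem_nhds ?_)
    simp [h0]
  obtain ⟨A, hA, B, hB, hAB⟩ := mem_nhds_prod_iff.1 h1
  obtain ⟨p, hp, hpB⟩ := exists_continuous_seminorm_ball_subset hB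
  refine ⟨p, hp, ?_⟩
  filter_upwards [hA, hU.mem_nhds hx] with z hzA hzU v
  have := le_mul_seminorm_of_forall_lt_one p (N := fun v => q (df (z, v)))
    (fun c v hc => by
      rw [map_smul_of_hasDirDeriv hdf hzU, map_smul_eq_mul, Real.norm_of_nonneg hc.le])
    (fun v hv => le_of_lt (hAB (mk_mem_prod hzA (hpB v hv)))) v
  simpa using this

/-- The differential of a real-valued `C²`-map is locally Lipschitz with respect to a single
continuous seminorm. -/
theorem exists_seminorm_lipschitz_differential {g : E → ℝ} {dg : E × E → ℝ} {U : Set E}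
    (hU : IsOpen U) (hdg : ∀ x ∈ U, ∀ y : E, HasDirDeriv g x y (dg (x, y)))
    (hC1 : IsCnOn 1 dg (U ×ˢ univ)) {x₀ : E} (hx₀ : x₀ ∈ U) :
    ∃ p : Seminorm ℝ E, Continuous p ∧ ∃ V ⊆ U, IsOpen V ∧ Convex ℝ V ∧ x₀ ∈ V ∧
      ∀ x ∈ V, ∀ z ∈ V, ∀ v, |dg (z, v) - dg (x, v)| ≤ p v * p (z - x) := by
  obtain ⟨hdgc, d2, hd2, hd2c⟩ := hC1
  have hUo : IsOpen (U ×ˢ (univ : Set E)) := hU.prod isOpen_univ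
  have hd2c : ContinuousOn d2 ((U ×ˢ (univ : Set E)) ×ˢ univ) := hd2c
  obtain ⟨P, hP, hPb⟩ := exists_seminorm_bound_differential hUo hd2 hd2c
    (⟨hx₀, mem_univ _⟩ : (x₀, (0 : E)) ∈ U ×ˢ univ) (q := normSeminorm ℝ ℝ) continuous_norm
  obtain ⟨A, hA, B, hB, hAB⟩ := mem_nhds_prod_iff.1 hPb
  obtain ⟨p₁, hp₁, hp₁B⟩ := exists_continuous_seminorm_ball_subset hB
  obtain ⟨p₂, hp₂, hp₂A⟩ := exists_continuous_seminorm_ball_subset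
    (N := {w | x₀ + w ∈ A ∩ U}) (by
      have : Continuous fun w : E => x₀ + w := by fun_prop
      exact this.continuousAt.preimage_mem_nhds
        (by simpa using inter_mem hA (hU.mem_nhds hx₀)))
  set p₃ : Seminorm ℝ E := P.comp (LinearMap.inl ℝ E E) with hp₃
  have hp₃c : Continuous p₃ := by
    change Continuous fun v : E => P (v, 0)
    exact hP.comp (by fun_prop)
  have hV : ∀ z ∈ p₂.ball x₀ 1, z ∈ A ∩ U := by
    intro z hz
    have := hp₂A (z - x₀) ((Seminorm.mem_ball p₂).1 hz)
    simpa using this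
  -- `p₂` keeps base points in `A ∩ U`, `p₁` measures the direction `v`, and `p₃` the displacement
  -- `z - x`; the sum merges the last two into one seminorm.
  refine ⟨p₁ + p₃, hp₁.add hp₃c, p₂.ball x₀ 1, fun z hz => (hV z hz).2, ?_,
    p₂.convex_ball _ _, by simp [Seminorm.mem_ball], ?_⟩
  · have : p₂.ball x₀ 1 = {z | p₂ (z - x₀) < 1} := by ext; simp [Seminorm.mem_ball]
    rw [this]
    exact isOpen_lt (hp₂.comp (by fun_prop)) continuous_const
  intro x hx z hz v
  -- Mean value theorem for `dg` with `v` frozen, that is, in direction `(z - x, 0)`; homogeneity in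
  -- `v` afterwards removes the restriction on `p₁ v`.
  have hbound : ∀ v, p₁ v < 1 → |dg (z, v) - dg (x, v)| ≤ p₃ (z - x) := by
    intro v hv
    have := sub_mem_of_forall_hasDirDeriv_mem (f := dg) (x := (x, v)) (v := (z - x, 0))
      (C := Metric.closedBall (0 : ℝ) (p₃ (z - x)))
      (d := fun s => d2 ((x, v) + s • (z - x, 0), (z - x, 0)))
      (convex_closedBall _ _) Metric.isClosed_closedBall ?_ ?_
    · simpa using this
    all_goals
      intro s hs
      have hmem : x + s • (z - x) ∈ p₂.ball x₀ 1 :=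
        (p₂.convex_ball x₀ 1).add_smul_sub_mem hx hz hs
    · exact hd2 _ ⟨by simpa using (hV _ hmem).2, mem_univ _⟩ _
    · have := hAB (mk_mem_prod (hV _ hmem).1 (hp₁B v hv)) (z - x, 0)
      rw [mem_closedBall_zero_iff]
      change ‖d2 ((x, v) + s • (z - x, 0), (z - x, 0))‖ ≤ P (z - x, 0)
      simpa using this
  have h3 := le_mul_seminorm_of_forall_lt_one p₁ (N := fun v => |dg (z, v) - dg (x, v)|)
    (fun c v hc => by
      rw [map_smul_of_hasDirDeriv hdg (hV z hz).2, map_smul_of_hasDirDeriv hdg (hV x hx).2,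
        ← smul_sub, smul_eq_mul, abs_mul, abs_of_pos hc]) hbound v
  calc |dg (z, v) - dg (x, v)| ≤ p₃ (z - x) * p₁ v := h3
    _ ≤ (p₁ + p₃) v * (p₁ + p₃) (z - x) := by
        rw [mul_comm]
        have a1 := apply_nonneg p₁ v
        have a2 := apply_nonneg p₁ (z - x)
        have a3 := apply_nonneg p₃ v
        have a4 := apply_nonneg p₃ (z - x)
        simp only [_root_.add_apply]
        gcongr <;> linarith

end DifferentialBounds

/-! ### `𝓛¹`-curves -/

section IntegrableCurves

variable {E : Type*} [AddCommGroup E] [Module ℝ E] [UniformSpace E] [IsFrechetSpace E]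
  {F : Type*} [AddCommGroup F] [Module ℝ F] [UniformSpace F] [IsFrechetSpace F]
  {a b α β : ℝ} {γ : ℝ → E}

/-- `E` is metrizable, so Borel measurability with separable image is strong measurability; the
latter is stable under products and continuous maps without fixing a σ-algebra on `E`. -/
theorem isL1On_iff : IsL1On γ a b ↔ StronglyMeasurable (fun t : Icc a b => γ t) ∧
    ∀ q : Seminorm ℝ E, Continuous q → ∫⁻ t in Icc a b, ENNReal.ofReal (q (γ t)) < ⊤ := by
  let _ : MeasurableSpace E := borel E
  have : BorelSpace E := ⟨rfl⟩
  have hr : range (fun t : Icc a b => γ t) = γ '' Icc a b := by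
    ext; simp
  have hsep : TopologicalSpace.SeparableSpace (γ '' Icc a b) ↔
      TopologicalSpace.IsSeparable (γ '' Icc a b) := by
    constructor
    · intro h
      have := TopologicalSpace.isSeparable_range
        (continuous_subtype_val : Continuous (Subtype.val : γ '' Icc a b → E))
      rwa [Subtype.range_val] at this
    · exact fun h => h.separableSpace
  rw [IsL1On, stronglyMeasurable_iff_measurable_separable, hr, ← hsep, and_assoc]

theorem IsL1On.mono (h : IsL1On γ a b) (hs : Icc α β ⊆ Icc a b) : IsL1On γ α β := by
  rw [isL1On_iff] at h ⊢
  refine ⟨h.1.comp_measurable (measurable_inclusion hs), fun q hq => ?_⟩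
  exact (lintegral_mono_set hs).trans_lt (h.2 q hq)

theorem IsL1On.prodMk {δ : ℝ → F} (h : IsL1On γ a b) (h' : IsL1On δ a b) :
    IsL1On (fun t => (γ t, δ t)) a b := by
  have hγ := isL1On_iff.1 h
  have hδ := isL1On_iff.1 h'
  refine isL1On_iff.2 ⟨hγ.1.prodMk hδ.1, fun q hq => ?_⟩
  set q₁ : Seminorm ℝ E := q.comp (LinearMap.inl ℝ E F)
  set q₂ : Seminorm ℝ F := q.comp (LinearMap.inr ℝ E F)
  have hq₁ : Continuous q₁ := by
    change Continuous fun v : E => q (v, 0)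
    exact hq.comp (by fun_prop)
  have hq₂ : Continuous q₂ := by
    change Continuous fun v : F => q (0, v)
    exact hq.comp (by fun_prop)
  have hm : AEMeasurable (fun t => ENNReal.ofReal (q₁ (γ t))) (volume.restrict (Icc a b)) := by
    rw [aemeasurable_restrict_iff_comap_subtype measurableSet_Icc]
    exact (hq₁.comp_stronglyMeasurable hγ.1).measurable.ennreal_ofReal.aemeasurable
  calc ∫⁻ t in Icc a b, ENNReal.ofReal (q (γ t, δ t))
      ≤ ∫⁻ t in Icc a b, (ENNReal.ofReal (q₁ (γ t)) + ENNReal.ofReal (q₂ (δ t))) := by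
        refine lintegral_mono fun t => ?_
        rw [← ENNReal.ofReal_add (apply_nonneg _ _) (apply_nonneg _ _)]
        refine ENNReal.ofReal_le_ofReal ?_
        change q (γ t, δ t) ≤ q (γ t, 0) + q (0, δ t)
        simpa using map_add_le_add q (γ t, 0) (0, δ t)
    _ = _ := lintegral_add_left' hm _
    _ < ⊤ := ENNReal.add_lt_top.2 ⟨hγ.2 _ hq₁, hδ.2 _ hq₂⟩

theorem IsL1On.integrableOn_comp (h : IsL1On γ a b) {φ : E → ℝ} (hφ : Continuous φ)
    {p : Seminorm ℝ E} (hp : Continuous p) (hle : ∀ v, |φ v| ≤ p v) :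
    IntegrableOn (fun t => φ (γ t)) (Icc a b) := by
  rw [isL1On_iff] at h
  refine ⟨?_, ?_⟩
  · refine AEMeasurable.aestronglyMeasurable ?_
    rw [aemeasurable_restrict_iff_comap_subtype measurableSet_Icc]
    exact (hφ.comp_stronglyMeasurable h.1).measurable.aemeasurable
  · rw [hasFiniteIntegral_iff_norm]
    refine (lintegral_mono fun t => ?_).trans_lt (h.2 p hp)
    exact ENNReal.ofReal_le_ofReal (hle _)

theorem IsL1On.integrableOn_seminorm (h : IsL1On γ a b) {p : Seminorm ℝ E} (hp : Continuous p) :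
    IntegrableOn (fun t => p (γ t)) (Icc a b) :=
  h.integrableOn_comp hp hp fun v => (abs_of_nonneg (apply_nonneg p v)).le

theorem IsL1On.integrableOn_clm (h : IsL1On γ a b) (l : E →L[ℝ] ℝ) :
    IntegrableOn (fun t => l (γ t)) (Icc a b) :=
  h.integrableOn_comp l.continuous (p := (normSeminorm ℝ ℝ).comp l.toLinearMap)
    (continuous_norm.comp l.continuous) fun _ => le_rfl

/-- Near each time, `q (df (η t, ·))` is dominated by a single continuous seminorm; compactness of
`[a,b]` leaves finitely many such bounds. -/
theorem IsL1On.differential {f : E → F} {df : E × E → F} {U : Set E}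
    (hU : IsOpen U) (hdf : ∀ x ∈ U, ∀ y : E, HasDirDeriv f x y (df (x, y)))
    (hc : ContinuousOn df (U ×ˢ univ)) {η : ℝ → E} (hη : ContinuousOn η (Icc a b))
    (hηU : MapsTo η (Icc a b) U) (hγ : IsL1On γ a b) :
    IsL1On (fun t => df (η t, γ t)) a b := by
  have hγ' := isL1On_iff.1 hγ
  refine isL1On_iff.2 ⟨?_, fun q hq => ?_⟩
  · have h1 : Continuous fun z : U × E => df (z.1, z.2) :=
      hc.comp_continuous (by fun_prop) fun z => ⟨z.1.2, mem_univ _⟩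
    have h2 : Continuous fun t : Icc a b => (⟨η t, hηU t.2⟩ : U) :=
      (continuousOn_iff_continuous_domRestrict.1 hη).subtype_mk _
    exact h1.comp_stronglyMeasurable (h2.stronglyMeasurable.prodMk hγ'.1)
  · suffices h : ∫⁻ t in Icc a b ∩ Icc a b, ENNReal.ofReal (q (df (η t, γ t))) < ⊤ by
      rwa [inter_self] at h
    refine isCompact_Icc.induction_on
      (p := fun s => ∫⁻ t in Icc a b ∩ s, ENNReal.ofReal (q (df (η t, γ t))) < ⊤) (by simp)
      (fun s t hst ht => (lintegral_mono_set (inter_subset_inter_right _ hst)).trans_lt ht)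
      (fun s t hs ht => ?_) fun t ht => ?_
    · rw [inter_union_distrib_left]
      exact (lintegral_union_le _ _ _).trans_lt (ENNReal.add_lt_top.2 ⟨hs, ht⟩)
    · obtain ⟨p, hp, hpb⟩ := exists_seminorm_bound_differential hU hdf hc (hηU ht) hq
      obtain ⟨u, hu, htu, hub⟩ := mem_nhdsWithin.1 ((hη t ht).eventually hpb)
      refine ⟨u, mem_nhdsWithin_of_mem_nhds (hu.mem_nhds htu), lt_of_le_of_lt ?_ (hγ'.2 p hp)⟩
      refine (setLIntegral_mono' (measurableSet_Icc.inter hu.measurableSet) fun r hr => ?_).trans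
        (lintegral_mono_set inter_subset_left)
      exact ENNReal.ofReal_le_ofReal (hub ⟨hr.2, hr.1⟩ _)

end IntegrableCurves

/-! ### Absolutely continuous curves in Fréchet spaces -/

section AbsolutelyContinuousCurves

section

variable {E : Type*} [AddCommGroup E] [Module ℝ E] [UniformSpace E] {a b : ℝ} {γ η : ℝ → E}

theorem isWeakIntegral_iff {t : ℝ} (h : a ≤ t) {w : E} :
    IsWeakIntegral γ a t w ↔ ∀ l : E →L[ℝ] ℝ, l w = ∫ s in a..t, l (γ s) := by
  simp only [IsWeakIntegral, integral_Icc_eq_integral_Ioc, intervalIntegral.integral_of_le h]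

theorem IsAbsContIcc.congr {η' : ℝ → E} (h : IsAbsContIcc η a b) (he : EqOn η η' (Icc a b)) :
    IsAbsContIcc η' a b := by
  obtain ⟨γ, hγ, hw⟩ := h
  refine ⟨γ, hγ, fun t ht => ?_⟩
  rw [← he ht, ← he (left_mem_Icc.2 (ht.1.trans ht.2))]
  exact hw t ht

end

variable {E : Type*} [AddCommGroup E] [Module ℝ E] [UniformSpace E] [IsFrechetSpace E]
  {F : Type*} [AddCommGroup F] [Module ℝ F] [UniformSpace F] [IsFrechetSpace F]
  {a b α β : ℝ} {γ η : ℝ → E}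

theorem IsL1On.intervalIntegrable_clm (h : IsL1On γ a b) (l : E →L[ℝ] ℝ) {s t : ℝ}
    (hs : s ∈ Icc a b) (ht : t ∈ Icc a b) :
    IntervalIntegrable (fun r => l (γ r)) volume s t :=
  ((h.integrableOn_clm l).mono_set (uIcc_subset_Icc hs ht)).intervalIntegrable

theorem clm_sub_eq_integral (hγ : IsL1On γ a b)
    (hw : ∀ t ∈ Icc a b, IsWeakIntegral γ a t (η t - η a)) (l : E →L[ℝ] ℝ) {s t : ℝ}
    (hs : s ∈ Icc a b) (ht : t ∈ Icc a b) : l (η t - η s) = ∫ r in s..t, l (γ r) := by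
  have ha : a ∈ Icc a b := left_mem_Icc.2 (hs.1.trans hs.2)
  have h1 := (isWeakIntegral_iff hs.1).1 (hw s hs) l
  have h2 := (isWeakIntegral_iff ht.1).1 (hw t ht) l
  have h3 := intervalIntegral.integral_add_adjacent_intervals
    (hγ.intervalIntegrable_clm l ha hs) (hγ.intervalIntegrable_clm l hs ht)
  rw [map_sub] at h1 h2 ⊢
  linarith

theorem IsAbsContIcc.mono (h : IsAbsContIcc η a b) (hs : Icc α β ⊆ Icc a b) :
    IsAbsContIcc η α β := by
  obtain ⟨γ, hγ, hw⟩ := h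
  refine ⟨γ, hγ.mono hs, fun t ht => (isWeakIntegral_iff ht.1).2 fun l => ?_⟩
  exact clm_sub_eq_integral hγ hw l (hs (left_mem_Icc.2 (ht.1.trans ht.2))) (hs ht)

theorem IsAbsContIcc.prodMk {ζ : ℝ → F} (h : IsAbsContIcc η a b) (h' : IsAbsContIcc ζ a b) :
    IsAbsContIcc (fun t => (η t, ζ t)) a b := by
  obtain ⟨γ, hγ, hw⟩ := h
  obtain ⟨δ, hδ, hv⟩ := h'
  refine ⟨fun t => (γ t, δ t), hγ.prodMk hδ, fun t ht => (isWeakIntegral_iff ht.1).2 fun l => ?_⟩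
  have ha : a ∈ Icc a b := left_mem_Icc.2 (ht.1.trans ht.2)
  have h1 := (isWeakIntegral_iff ht.1).1 (hw t ht) (l.comp (ContinuousLinearMap.inl ℝ E F))
  have h2 := (isWeakIntegral_iff ht.1).1 (hv t ht) (l.comp (ContinuousLinearMap.inr ℝ E F))
  have h3 := intervalIntegral.integral_add
    (hγ.intervalIntegrable_clm (l.comp (ContinuousLinearMap.inl ℝ E F)) ha ht)
    (hδ.intervalIntegrable_clm (l.comp (ContinuousLinearMap.inr ℝ E F)) ha ht)
  simp only [ContinuousLinearMap.comp_apply, ContinuousLinearMap.inl_apply,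
    ContinuousLinearMap.inr_apply, ← map_add, Prod.mk_add_mk, add_zero, zero_add] at h1 h2 h3
  rw [h3, ← h1, ← h2, ← map_add]
  simp

/-- A continuous function whose increments are, to the right of each point, of smaller order than
those of `P` is constant. -/
theorem eq_zero_of_local_bound {H P : ℝ → ℝ} (hH : ContinuousOn H (Icc a b))
    (hP : ContinuousOn P (Icc a b)) (hHa : H a = 0) (hPa : P a = 0)
    (hloc : ∀ t ∈ Icc a b, ∀ ε > 0, ∀ᶠ s in 𝓝[>] t, s ∈ Icc a b →
      |H s - H t| ≤ ε * (P s - P t)) : ∀ t ∈ Icc a b, H t = 0 := by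
  intro t ht
  have key : ∀ ε > 0, |H t| ≤ ε * P t := by
    intro ε hε
    -- Continuous induction: the set where `|H s| ≤ ε * P s` is closed, contains `a`, and can be
    -- continued to the right of each of its points.
    have hsub : Icc a b ⊆ {s | s ∈ Icc a b ∧ |H s| ≤ ε * P s} := by
      refine IsClosed.Icc_subset_of_forall_exists_gt ?_ ?_ ?_
      · have : {s | s ∈ Icc a b ∧ |H s| ≤ ε * P s} ∩ Icc a b =
            {s | s ∈ Icc a b ∧ |H s| ≤ ε * P s} := inter_eq_left.2 fun s hs => hs.1
        rw [this]
        exact isClosed_Icc.isClosed_le hH.abs (hP.const_mul ε |>.congr fun _ _ => rfl)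
      · exact ⟨left_mem_Icc.2 (ht.1.trans ht.2), by simp [hHa, hPa]⟩
      · rintro x ⟨⟨hxI, hx⟩, hxab⟩ y hy
        have hxy : x < min y b := lt_min hy hxab.2
        obtain ⟨s, hs, hsI⟩ := ((hloc x hxI ε hε).and (Ioc_mem_nhdsGT hxy)).exists
        have hsab : s ∈ Icc a b := ⟨hxI.1.trans hsI.1.le, hsI.2.trans (min_le_right _ _)⟩
        refine ⟨s, ⟨hsab, ?_⟩, hsI.1, hsI.2.trans (min_le_left _ _)⟩
        have h1 := hs hsab
        have h2 := abs_add_le (H s - H x) (H x)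
        rw [sub_add_cancel] at h2
        linarith
    exact (hsub ht).2
  have hlim : Tendsto (fun ε : ℝ => ε * P t) (𝓝[>] 0) (𝓝 (0 * P t)) :=
    ((continuous_id.mul continuous_const).tendsto 0).mono_left nhdsWithin_le_nhds
  rw [zero_mul] at hlim
  have : |H t| ≤ 0 := by
    refine ge_of_tendsto hlim ?_
    filter_upwards [self_mem_nhdsWithin] with ε hε using key ε hε
  exact abs_nonpos_iff.1 this

/-- Finitely many local seminorms are added up. Only `V` may depend on the point: `∫ p(γ)` has to be
one comparison function for the whole curve. -/
theorem exists_uniform_seminorm_lipschitz_differential {g : E → ℝ} {dg : E × E → ℝ} {U : Set E}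
    (hU : IsOpen U) (hdg : ∀ x ∈ U, ∀ y : E, HasDirDeriv g x y (dg (x, y)))
    (hC1 : IsCnOn 1 dg (U ×ˢ univ)) {K : Set E} (hK : IsCompact K) (hKU : K ⊆ U) :
    ∃ p : Seminorm ℝ E, Continuous p ∧ ∀ x₀ ∈ K, ∃ V ⊆ U, IsOpen V ∧ Convex ℝ V ∧ x₀ ∈ V ∧
      ∀ x ∈ V, ∀ z ∈ V, ∀ v, |dg (z, v) - dg (x, v)| ≤ p v * p (z - x) := by
  refine hK.induction_on (p := fun s => ∃ p : Seminorm ℝ E, Continuous p ∧ ∀ x₀ ∈ s, ∃ V ⊆ U,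
      IsOpen V ∧ Convex ℝ V ∧ x₀ ∈ V ∧
      ∀ x ∈ V, ∀ z ∈ V, ∀ v, |dg (z, v) - dg (x, v)| ≤ p v * p (z - x))
    ⟨0, continuous_const, by simp⟩ ?_ ?_ ?_
  · rintro s t hst ⟨p, hp, h⟩
    exact ⟨p, hp, fun x hx => h x (hst hx)⟩
  · rintro s t ⟨p, hp, h⟩ ⟨q, hq, h'⟩
    refine ⟨p + q, hp.add hq, fun x₀ hx₀ => ?_⟩
    rcases hx₀ with hx₀ | hx₀
    · obtain ⟨V, hVU, hV, hVc, hxV, hb⟩ := h x₀ hx₀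
      refine ⟨V, hVU, hV, hVc, hxV, fun x hx z hz v => (hb x hx z hz v).trans ?_⟩
      have a1 := apply_nonneg p v
      have a2 := apply_nonneg q v
      have a3 := apply_nonneg p (z - x)
      have a4 := apply_nonneg q (z - x)
      simp only [_root_.add_apply]
      gcongr <;> linarith
    · obtain ⟨V, hVU, hV, hVc, hxV, hb⟩ := h' x₀ hx₀
      refine ⟨V, hVU, hV, hVc, hxV, fun x hx z hz v => (hb x hx z hz v).trans ?_⟩
      have a1 := apply_nonneg p v
      have a2 := apply_nonneg q v
      have a3 := apply_nonneg p (z - x)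
      have a4 := apply_nonneg q (z - x)
      simp only [_root_.add_apply]
      gcongr <;> linarith
  · intro x₀ hx₀
    obtain ⟨p, hp, V, hVU, hV, hVc, hxV, hb⟩ :=
      exists_seminorm_lipschitz_differential hU hdg hC1 (hKU hx₀)
    exact ⟨V, mem_nhdsWithin_of_mem_nhds (hV.mem_nhds hxV), p, hp,
      fun x₁ hx₁ => ⟨V, hVU, hV, hVc, hx₁, hb⟩⟩

/-- Fundamental theorem of calculus for a real-valued `C²`-map along an absolutely continuous
curve. -/
theorem sub_eq_integral_differential {g : E → ℝ} {dg : E × E → ℝ} {U : Set E}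
    (hU : IsOpen U) (hdg : ∀ x ∈ U, ∀ y : E, HasDirDeriv g x y (dg (x, y)))
    (hC1 : IsCnOn 1 dg (U ×ˢ univ)) (hgc : ContinuousOn g U)
    (hη : ContinuousOn η (Icc a b)) (hηU : MapsTo η (Icc a b) U) (hγ : IsL1On γ a b)
    (hw : ∀ t ∈ Icc a b, IsWeakIntegral γ a t (η t - η a)) :
    ∀ t ∈ Icc a b, g (η t) - g (η a) = ∫ r in a..t, dg (η r, γ r) := by
  intro t₀ ht₀
  have hab : a ≤ b := ht₀.1.trans ht₀.2
  have ha : a ∈ Icc a b := left_mem_Icc.2 hab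
  have hdL1 : IsL1On (fun t => dg (η t, γ t)) a b :=
    hγ.differential hU hdg hC1.continuousOn hη hηU
  have hdint : IntegrableOn (fun t => dg (η t, γ t)) (Icc a b) :=
    hdL1.integrableOn_clm (ContinuousLinearMap.id ℝ ℝ)
  obtain ⟨p, hp, hpK⟩ := exists_uniform_seminorm_lipschitz_differential hU hdg hC1
    (isCompact_Icc.image_of_continuousOn hη) (image_subset_iff.2 hηU)
  have hpint : IntegrableOn (fun t => p (γ t)) (Icc a b) := hγ.integrableOn_seminorm hp
  have hii : ∀ {φ : ℝ → ℝ}, IntegrableOn φ (Icc a b) → ∀ {s t}, s ∈ Icc a b → t ∈ Icc a b →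
      IntervalIntegrable φ volume s t := fun hφ s t hs ht =>
    (hφ.mono_set (uIcc_subset_Icc hs ht)).intervalIntegrable
  have hprim : ∀ {φ : ℝ → ℝ}, IntegrableOn φ (Icc a b) →
      ContinuousOn (fun t => ∫ r in a..t, φ r) (Icc a b) := fun hφ => by
    have := intervalIntegral.continuousOn_primitive_interval (a := a) (b := b)
      (by rwa [uIcc_of_le hab])
    rwa [uIcc_of_le hab] at this
  -- `H` is the defect in the claimed formula and `P` the primitive of `p ∘ γ`. As `p` comes from
  -- the `C²` Lipschitz bound, it does not depend on `ε`.
  have hzero := eq_zero_of_local_bound (a := a) (b := b)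
    (H := fun t => g (η t) - g (η a) - ∫ r in a..t, dg (η r, γ r))
    (P := fun t => ∫ r in a..t, p (γ r))
    (((hgc.comp hη hηU).sub continuousOn_const).sub (hprim hdint)) (hprim hpint) (by simp)
    (by simp) ?_ t₀ ht₀
  · exact sub_eq_zero.1 hzero
  intro t ht ε hε
  obtain ⟨V, hVU, hV, hVc, htV, hb⟩ := hpK (η t) (mem_image_of_mem η ht)
  -- Radius `ε / 2`, so that any two points of the ball are at `p`-distance at most `ε`.
  have hWo : IsOpen (V ∩ p.ball (η t) (ε / 2)) := by
    have : p.ball (η t) (ε / 2) = {z | p (z - η t) < ε / 2} := by ext; simp [Seminorm.mem_ball]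
    rw [this]
    exact hV.inter (isOpen_lt (hp.comp (by fun_prop)) continuous_const)
  have hWc : Convex ℝ (V ∩ p.ball (η t) (ε / 2)) := hVc.inter (p.convex_ball _ _)
  have htW : η t ∈ V ∩ p.ball (η t) (ε / 2) := ⟨htV, by simp [Seminorm.mem_ball, hε]⟩
  have hWb : ∀ x ∈ V ∩ p.ball (η t) (ε / 2), ∀ z ∈ V ∩ p.ball (η t) (ε / 2), ∀ v,
      |dg (z, v) - dg (x, v)| ≤ ε * p v := by
    intro x hx z hz v
    refine (hb x hx.1 z hz.1 v).trans ?_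
    rw [mul_comm]
    gcongr
    · have h1 := hx.2
      have h2 := hz.2
      rw [Seminorm.mem_ball] at h1 h2
      have h3 := map_sub_le_add p (z - η t) (x - η t)
      rw [sub_sub_sub_cancel_right] at h3
      linarith
  obtain ⟨u, hu, htu, hub⟩ := mem_nhdsWithin.1 ((hη t ht).eventually (hWo.mem_nhds htW))
  obtain ⟨t', htt', hsub⟩ := exists_Ico_subset_of_mem_nhds (hu.mem_nhds htu) (exists_gt t)
  filter_upwards [Ioo_mem_nhdsGT htt'] with s hs hsab
  have hmem : ∀ r ∈ Icc t s, η r ∈ V ∩ p.ball (η t) (ε / 2) := fun r hr =>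
    hub ⟨hsub ⟨hr.1, hr.2.trans_lt hs.2⟩, ht.1.trans hr.1, hr.2.trans hsab.2⟩
  have hts : t ≤ s := hs.1.le
  set I := ∫ r in t..s, dg (η r, γ r) with hI
  set Q := ∫ r in t..s, p (γ r) with hQ
  have h1 : (∫ r in a..s, dg (η r, γ r)) = (∫ r in a..t, dg (η r, γ r)) + I :=
    (intervalIntegral.integral_add_adjacent_intervals (hii hdint ha ht) (hii hdint ht hsab)).symm
  have h2 : (∫ r in a..s, p (γ r)) = (∫ r in a..t, p (γ r)) + Q :=
    (intervalIntegral.integral_add_adjacent_intervals (hii hpint ha ht) (hii hpint ht hsab)).symm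
  have h3 : g (η t + (η s - η t)) - g (η t) ∈ Metric.closedBall I (ε * Q) := by
    refine sub_mem_of_forall_hasDirDeriv_mem
      (d := fun θ => dg (η t + θ • (η s - η t), η s - η t)) (convex_closedBall _ _)
      Metric.isClosed_closedBall (fun θ hθ => ?_) fun θ hθ => ?_
    all_goals
      have hξ : η t + θ • (η s - η t) ∈ V ∩ p.ball (η t) (ε / 2) :=
        hWc.add_smul_sub_mem htW (hmem s ⟨hts, le_rfl⟩) hθ
    · exact hdg _ (hVU hξ.1) _
    -- For fixed `ξ`, `dg (ξ, ·)` is a continuous functional, so the weak integral turns `dg (ξ, η s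
    -- - η t)` into `∫ dg (ξ, γ r)`; replacing `ξ` by `η r` costs at most `ε * p (γ r)`.
    · have hL := clm_sub_eq_integral hγ hw
        (differentialCLM hU hdg hC1.continuousOn (hVU hξ.1)) ht hsab
      have hLi := hγ.intervalIntegrable_clm
        (differentialCLM hU hdg hC1.continuousOn (hVU hξ.1)) ht hsab
      simp only [differentialCLM, ContinuousLinearMap.coe_mk', LinearMap.coe_mk,
        AddHom.coe_mk] at hL hLi
      rw [Metric.mem_closedBall, Real.dist_eq, hL, hI,
        ← intervalIntegral.integral_sub hLi (hii hdint ht hsab), hQ,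
        ← intervalIntegral.integral_const_mul, ← Real.norm_eq_abs]
      refine intervalIntegral.norm_integral_le_of_norm_le hts (Eventually.of_forall fun r hr => ?_)
        ((hii hpint ht hsab).const_mul ε)
      exact hWb _ (hmem r (Ioc_subset_Icc_self hr)) _ hξ _
  rw [add_sub_cancel, Metric.mem_closedBall, Real.dist_eq] at h3
  simp only [h1, h2]
  calc _ = |g (η s) - g (η t) - I| := by congr 1; ring
    _ ≤ ε * Q := h3
    _ = _ := by ring

/-- Compositions of `C²`-maps with absolutely continuous curves are absolutely continuous. -/
theorem IsAbsContIcc.comp_isCnOn {f : E → F} {U : Set E} (hU : IsOpen U) (hf : IsCnOn 2 f U)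
    (hη : ContinuousOn η (Icc a b)) (hηU : MapsTo η (Icc a b) U) (h : IsAbsContIcc η a b) :
    IsAbsContIcc (f ∘ η) a b := by
  obtain ⟨γ, hγ, hw⟩ := h
  obtain ⟨hfc, df, hdf, hdf1⟩ := hf
  refine ⟨fun t => df (η t, γ t), hγ.differential hU hdf hdf1.continuousOn hη hηU,
    fun t ht => (isWeakIntegral_iff ht.1).2 fun l => ?_⟩
  -- A weak integral is determined by functionals, so the scalar formula for each `l ∘ f` suffices.
  have := sub_eq_integral_differential (g := l ∘ f) (dg := l ∘ df) hU
    (fun x hx y => ?_)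
    ((l.isCnOn univ).comp isOpen_univ hdf1 (mapsTo_univ _ _))
    (l.continuous.comp_continuousOn hfc) hη hηU hγ hw t ht
  · simpa using this
  · refine ((l.continuous.tendsto _).comp (hdf x hx y)).congr fun t => ?_
    simp

/-- An absolutely continuous curve whose velocity vanishes almost everywhere is constant. -/
theorem IsAbsContIcc.eq_of_ae_slope_tendsto_zero (h : IsAbsContIcc η a b)
    (hv : ∀ᵐ t : ℝ, t ∈ Icc a b → Tendsto (slope η t) (𝓝[Icc a b \ {t}] t) (𝓝 0)) :
    ∀ t ∈ Icc a b, η t = η a := by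
  obtain ⟨γ, hγ, hw⟩ := h
  intro t ht
  have ha : a ∈ Icc a b := left_mem_Icc.2 (ht.1.trans ht.2)
  have hb : b ∈ Icc a b := right_mem_Icc.2 (ht.1.trans ht.2)
  have hab : a ≤ b := ht.1.trans ht.2
  by_contra hne
  obtain ⟨l, hl⟩ := geometric_hahn_banach_point_point hne
  -- Lebesgue differentiation of the primitive of `l ∘ γ`. The null set depends on `l`, which is
  -- harmless because a single separating functional is enough.
  have hzero : ∀ᵐ r : ℝ, r ∈ Ioo a b → l (γ r) = 0 := by
    filter_upwards [hv, (hγ.intervalIntegrable_clm l ha hb).ae_hasDerivAt_integral] with r h1 h2 hr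
    have hrI := Ioo_subset_Icc_self hr
    have h3 := hasDerivAt_iff_tendsto_slope.1
      (h2 (by rwa [uIcc_of_le hab]) a (by rwa [uIcc_of_le hab]))
    have h4 := (l.continuous.tendsto _).comp (h1 hrI)
    rw [map_zero] at h4
    have h5 : 𝓝[Icc a b \ {r}] r = 𝓝[≠] r := by
      rw [sdiff_eq, inter_comm]
      exact nhdsWithin_inter_of_mem' (mem_nhdsWithin_of_mem_nhds (Icc_mem_nhds hr.1 hr.2))
    rw [h5] at h4
    refine tendsto_nhds_unique h3 (h4.congr' ?_)
    filter_upwards [mem_nhdsWithin_of_mem_nhds (Icc_mem_nhds hr.1 hr.2)] with s hs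
    have h6 := clm_sub_eq_integral hγ hw l ha hs
    have h7 := clm_sub_eq_integral hγ hw l ha hrI
    simp only [Function.comp_apply, slope_def_module, map_smul]
    rw [← h6, ← h7, ← map_sub, sub_sub_sub_cancel_right]
  have h8 := clm_sub_eq_integral hγ hw l ha ht
  rw [intervalIntegral.integral_zero_ae] at h8
  · rw [map_sub] at h8
    linarith
  · filter_upwards [hzero, compl_mem_ae_iff.2 (measure_singleton b)] with r hr hrb hrt
    rw [uIoc_of_le ht.1] at hrt
    exact hr ⟨hrt.1, lt_of_le_of_ne (hrt.2.trans ht.2) hrb⟩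

end AbsolutelyContinuousCurves

/-! ### Smooth maps between Fréchet manifolds -/

section SmoothMaps

theorem isOpen_chart_domain {E F M N : Type*} [TopologicalSpace E] [TopologicalSpace F]
    [TopologicalSpace M] [TopologicalSpace N] {f : M → N} (hf : ContinuousOn f univ)
    (e : OpenPartialHomeomorph M E) (e' : OpenPartialHomeomorph N F) :
    IsOpen (e.target ∩ e.symm ⁻¹' (univ ∩ f ⁻¹' e'.source)) := by
  rw [univ_inter]
  exact e.isOpen_inter_preimage_symm (e'.open_source.preimage (continuousOn_univ.1 hf))

section

variable {E : Type*} [AddCommGroup E] [Module ℝ E] [UniformSpace E]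
  {F : Type*} [AddCommGroup F] [Module ℝ F] [UniformSpace F]
  {H : Type*} [AddCommGroup H] [Module ℝ H] [UniformSpace H]
  {M : Type*} [TopologicalSpace M] [ChartedSpace E M]
  {N : Type*} [TopologicalSpace N] [ChartedSpace F N]
  {P : Type*} [TopologicalSpace P] [ChartedSpace H P]

theorem IsCkMapOn.isCnOn {f : M → N} (hf : IsCkMapOn ⊤ E F f univ)
    {e : OpenPartialHomeomorph M E} (he : e ∈ atlas E M)
    {e' : OpenPartialHomeomorph N F} (he' : e' ∈ atlas F N) (n : ℕ) :
    IsCnOn n (e' ∘ f ∘ e.symm) (e.target ∩ e.symm ⁻¹' (univ ∩ f ⁻¹' e'.source)) :=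
  hf.2 e he e' he' n le_top

theorem IsCkMapOn.prodMk {f : M → N} {g : M → P} (hf : IsCkMapOn ⊤ E F f univ)
    (hg : IsCkMapOn ⊤ E H g univ) : IsCkMapOn ⊤ E (F × H) (fun x => (f x, g x)) univ := by
  refine ⟨hf.1.prodMk hg.1, fun e he e' he' n _ => ?_⟩
  obtain ⟨e₁, he₁, e₂, he₂, rfl⟩ := he'
  exact ((hf.2 e he e₁ he₁ n le_top).mono fun z hz => ⟨hz.1, mem_univ _, hz.2.2.1⟩).prodMk
    ((hg.2 e he e₂ he₂ n le_top).mono fun z hz => ⟨hz.1, mem_univ _, hz.2.2.2⟩)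

theorem isCkMapOn_const (c : N) : IsCkMapOn ⊤ E F (fun _ : M => c) univ :=
  ⟨continuousOn_const, fun _ _ e' _ _ _ => IsCnOn.const (e' c) _⟩

/-- Read in two charts, the identity is their transition map; changes of chart thus become an
instance of the chain rule. -/
theorem IsFrechetManifold.isCkMapOn_id (hM : IsFrechetManifold ⊤ E M) :
    IsCkMapOn ⊤ E E (fun x : M => x) univ := by
  refine ⟨continuousOn_id, fun e he e' he' n _ => ?_⟩
  exact (hM.compatible e he e' he' n le_top).mono fun z hz => ⟨hz.1, hz.2.2⟩

theorem HasVelocityWithinAt.prodMk {c : ℝ → M} {I : Set ℝ} {t : ℝ} {d : ℝ → N} {v : E} {w : F}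
    (hv : HasVelocityWithinAt E c I t v) (hw : HasVelocityWithinAt F d I t w) :
    HasVelocityWithinAt (E × F) (fun s => (c s, d s)) I t (v, w) :=
  Tendsto.prodMk_nhds hv hw

end

variable {E : Type*} [AddCommGroup E] [Module ℝ E] [UniformSpace E] [IsFrechetSpace E]
  {F : Type*} [AddCommGroup F] [Module ℝ F] [UniformSpace F] [IsFrechetSpace F]
  {H : Type*} [AddCommGroup H] [Module ℝ H] [UniformSpace H] [IsFrechetSpace H]
  {M : Type*} [TopologicalSpace M] [ChartedSpace E M]
  {N : Type*} [TopologicalSpace N] [ChartedSpace F N]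
  {P : Type*} [TopologicalSpace P] [ChartedSpace H P]

theorem IsCkMapOn.comp {g : N → P} {f : M → N} (hg : IsCkMapOn ⊤ F H g univ)
    (hf : IsCkMapOn ⊤ E F f univ) : IsCkMapOn ⊤ E H (g ∘ f) univ := by
  have hgf : ContinuousOn (g ∘ f) univ := hg.1.comp hf.1 (mapsTo_univ _ _)
  refine ⟨hgf, fun e he e'' he'' n _ => IsCnOn.of_locally fun x hx => ?_⟩
  -- The intermediate chart depends on the point, hence the reduction to a local statement.
  have he' := chart_mem_atlas F (f (e.symm x))
  set e' := chartAt F (f (e.symm x)) with he'_def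
  have hV := (isOpen_chart_domain hf.1 e e').inter (isOpen_chart_domain hgf e e'')
  refine ⟨_, hV, ⟨⟨hx.1, mem_univ _, mem_chart_source F _⟩, hx⟩, ?_⟩
  refine (IsCnOn.comp (isOpen_chart_domain hg.1 e' e'') (hg.isCnOn he' he'' n)
    ((hf.isCnOn he he' n).mono inter_subset_left) ?_).congr hV ?_
  · rintro z ⟨⟨hz, -, hz'⟩, -, -, hz''⟩
    have hz' : f (e.symm z) ∈ e'.source := hz'
    refine ⟨e'.map_source hz', mem_univ _, ?_⟩
    simp only [Function.comp_apply, mem_preimage, e'.left_inv hz']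
    exact hz''
  · rintro z ⟨⟨hz, -, hz'⟩, -⟩
    have hz' : f (e.symm z) ∈ e'.source := hz'
    simp only [Function.comp_apply, e'.left_inv hz']

theorem IsFrechetManifold.prod (hM : IsFrechetManifold ⊤ E M) (hN : IsFrechetManifold ⊤ F N) :
    IsFrechetManifold ⊤ (E × F) (M × N) := by
  have := hM.hausdorff
  have := hN.hausdorff
  refine ⟨inferInstance, inferInstance, fun e he e' he' n hn => ?_⟩
  obtain ⟨e₁, he₁, e₂, he₂, rfl⟩ := he
  obtain ⟨e₁', he₁', e₂', he₂', rfl⟩ := he'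
  exact (IsCnOn.comp (g := e₁' ∘ e₁.symm) (e₁.isOpen_inter_preimage_symm e₁'.open_source)
      (hM.compatible e₁ he₁ e₁' he₁' n hn) ((ContinuousLinearMap.fst ℝ E F).isCnOn _)
      fun z hz => ⟨hz.1.1, hz.2.1⟩).prodMk
    (IsCnOn.comp (g := e₂' ∘ e₂.symm) (e₂.isOpen_inter_preimage_symm e₂'.open_source)
      (hN.compatible e₂ he₂ e₂' he₂' n hn) ((ContinuousLinearMap.snd ℝ E F).isCnOn _)
      fun z hz => ⟨hz.1.2, hz.2.2⟩)

theorem IsFrechetManifold.isCkMapOn_fst {F : Type*} [AddCommGroup F] [Module ℝ F] [UniformSpace F]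
    {N : Type*} [TopologicalSpace N] [ChartedSpace F N]
    (hM : IsFrechetManifold ⊤ E M) :
    IsCkMapOn ⊤ (E × F) E (fun p : M × N => p.1) univ := by
  refine ⟨continuousOn_fst, fun e he e' he' n _ => ?_⟩
  obtain ⟨e₁, he₁, e₂, he₂, rfl⟩ := he
  exact IsCnOn.comp (g := e' ∘ e₁.symm) (e₁.isOpen_inter_preimage_symm e'.open_source)
    (hM.compatible e₁ he₁ e' he' n le_top)
    ((ContinuousLinearMap.fst ℝ E F).isCnOn _) fun z hz => ⟨hz.1.1, hz.2.2⟩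

theorem IsFrechetManifold.isCkMapOn_snd {E : Type*} [AddCommGroup E] [Module ℝ E] [UniformSpace E]
    {M : Type*} [TopologicalSpace M] [ChartedSpace E M]
    (hN : IsFrechetManifold ⊤ F N) :
    IsCkMapOn ⊤ (E × F) F (fun p : M × N => p.2) univ := by
  refine ⟨continuousOn_snd, fun e he e' he' n _ => ?_⟩
  obtain ⟨e₁, he₁, e₂, he₂, rfl⟩ := he
  exact IsCnOn.comp (g := e' ∘ e₂.symm) (e₂.isOpen_inter_preimage_symm e'.open_source)
    (hN.compatible e₂ he₂ e' he' n le_top)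
    ((ContinuousLinearMap.snd ℝ E F).isCnOn _) fun z hz => ⟨hz.1.2, hz.2.2⟩

end SmoothMaps

/-! ### Velocities of curves -/

section Velocities

variable {E : Type*} [AddCommGroup E] [Module ℝ E] [UniformSpace E] [IsFrechetSpace E]
  {F : Type*} [AddCommGroup F] [Module ℝ F] [UniformSpace F] [IsFrechetSpace F]
  {M : Type*} [TopologicalSpace M] [ChartedSpace E M]
  {N : Type*} [TopologicalSpace N] [ChartedSpace F N]
  {c : ℝ → M} {I : Set ℝ} {t : ℝ}

theorem IsCkMapOn.exists_hasDirDeriv {E : Type*} [AddCommGroup E] [Module ℝ E] [UniformSpace E]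
    {M : Type*} [TopologicalSpace M] [ChartedSpace E M]
    {f : M → N} (hf : IsCkMapOn ⊤ E F f univ)
    {e : OpenPartialHomeomorph M E} (he : e ∈ atlas E M)
    {e' : OpenPartialHomeomorph N F} (he' : e' ∈ atlas F N) {x : M} (hx : x ∈ e.source)
    (hfx : f x ∈ e'.source) (v : E) :
    HasDirDeriv (e' ∘ f ∘ e.symm) (e x) v (dirDeriv (e' ∘ f ∘ e.symm) (e x) v) := by
  obtain ⟨-, df, hdf, -⟩ := hf.isCnOn he he' 1
  have hxU : e x ∈ e.target ∩ e.symm ⁻¹' (univ ∩ f ⁻¹' e'.source) := by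
    refine ⟨e.map_source hx, mem_univ _, ?_⟩
    simpa [e.left_inv hx] using hfx
  rw [(hdf _ hxU v).dirDeriv_eq]
  exact hdf _ hxU v

/-- Chain rule for velocities, read in arbitrary charts. -/
theorem IsCkMapOn.tendsto_slope_chart {f : M → N} (hf : IsCkMapOn ⊤ E F f univ)
    {e : OpenPartialHomeomorph M E} (he : e ∈ atlas E M)
    {e' : OpenPartialHomeomorph N F} (he' : e' ∈ atlas F N)
    (hc : ContinuousWithinAt c I t) (hx : c t ∈ e.source)
    (hfx : f (c t) ∈ e'.source) {v : E}
    (hv : Tendsto (slope (e ∘ c) t) (𝓝[I \ {t}] t) (𝓝 v)) :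
    Tendsto (slope (e' ∘ f ∘ c) t) (𝓝[I \ {t}] t)
      (𝓝 (dirDeriv (e' ∘ f ∘ e.symm) (e (c t)) v)) := by
  obtain ⟨-, df, hdf, hdfc⟩ := hf.isCnOn he he' 1
  have hxU : e (c t) ∈ e.target ∩ e.symm ⁻¹' (univ ∩ f ⁻¹' e'.source) := by
    refine ⟨e.map_source hx, mem_univ _, ?_⟩
    simpa [e.left_inv hx] using hfx
  rw [(hdf _ hxU v).dirDeriv_eq]
  have hh : Tendsto (fun s : ℝ => s - t) (𝓝[I \ {t}] t) (𝓝[≠] 0) := by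
    refine tendsto_nhdsWithin_of_tendsto_nhds_of_eventually_within _ ?_ ?_
    · have : Continuous fun s : ℝ => s - t := by fun_prop
      have := this.tendsto t
      rw [sub_self] at this
      exact this.mono_left nhdsWithin_le_nhds
    · filter_upwards [self_mem_nhdsWithin] with s hs
      exact sub_ne_zero.2 hs.2
  refine (tendsto_differenceQuotient_comp (isOpen_chart_domain hf.1 e e') hdf hdfc hxU
    (c := fun s => e (c s)) hh (hv.congr fun s => slope_def_module _ _ _)).congr' ?_
  have hc' : ContinuousWithinAt c (I \ {t}) t := hc.mono sdiff_subset
  filter_upwards [hc'.eventually (e.open_source.mem_nhds hx)] with s hs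
  simp only [slope_def_module, Function.comp_apply, e.left_inv hs, e.left_inv hx]

/-- The base point `x` is only propositionally equal to `c t`, so that the tangent map can be taken
at a prescribed point, such as `1`, with its own preferred chart. -/
theorem IsCkMapOn.hasVelocityWithinAt {f : M → N} (hf : IsCkMapOn ⊤ E F f univ)
    (hc : ContinuousWithinAt c I t) {x : M} (hx : c t = x) {v : E}
    (hv : HasVelocityWithinAt E c I t v) :
    HasVelocityWithinAt F (f ∘ c) I t (tangentMapAt E F f x v) := by
  subst hx
  exact hf.tendsto_slope_chart (chart_mem_atlas _ _) (chart_mem_atlas _ _) hc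
    (mem_chart_source _ _) (mem_chart_source _ _) hv

theorem HasVelocityWithinAt.unique (hI : (𝓝[I \ {t}] t).NeBot) {v w : E}
    (hv : HasVelocityWithinAt E c I t v) (hw : HasVelocityWithinAt E c I t w) : v = w :=
  tendsto_nhds_unique hv hw

/-- A velocity zero is zero in every chart. -/
theorem HasVelocityWithinAt.tendsto_slope_zero (hM : IsFrechetManifold ⊤ E M)
    (hc : ContinuousWithinAt c I t) (hv : HasVelocityWithinAt E c I t (0 : E))
    {e : OpenPartialHomeomorph M E} (he : e ∈ atlas E M) (hx : c t ∈ e.source) :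
    Tendsto (slope (e ∘ c) t) (𝓝[I \ {t}] t) (𝓝 0) := by
  have h := hM.isCkMapOn_id.tendsto_slope_chart (chart_mem_atlas E (c t)) he hc
    (mem_chart_source _ _) hx hv
  -- The differential of the chart change vanishes at `0 = 0 • 0` by homogeneity.
  have h0 := (hM.isCkMapOn_id.exists_hasDirDeriv (chart_mem_atlas E (c t)) he
    (mem_chart_source _ _) hx 0).smul 0
  rw [smul_zero, zero_smul] at h0
  rwa [h0.dirDeriv_eq] at h

/-- Every tangent vector is the velocity of a continuous curve germ. -/
theorem exists_curve_hasVelocityWithinAt (x : M) (v : E) :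
    ∃ h : ℝ → M, h 0 = x ∧ ContinuousAt h 0 ∧ HasVelocityWithinAt E h univ 0 v := by
  set e := chartAt E x
  have hx : x ∈ e.source := mem_chart_source E x
  have hcont : Continuous fun s : ℝ => e x + s • v := by fun_prop
  have h0 : Tendsto (fun s : ℝ => e x + s • v) (𝓝 0) (𝓝 (e x)) := by
    simpa using hcont.tendsto 0
  refine ⟨fun s => e.symm (e x + s • v), by simp [e.left_inv hx], ?_, ?_⟩
  · refine ContinuousAt.comp ?_ hcont.continuousAt
    simpa using e.continuousAt_symm (e.map_source hx)
  · have hx0 : e.symm (e x + (0 : ℝ) • v) = x := by simp [e.left_inv hx]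
    change Tendsto (slope (chartAt E (e.symm (e x + (0 : ℝ) • v)) ∘ _) 0) _ (𝓝 v)
    rw [hx0]
    refine tendsto_const_nhds.congr' ?_
    filter_upwards [self_mem_nhdsWithin,
      mem_nhdsWithin_of_mem_nhds (h0 (e.open_target.mem_nhds (e.map_source hx)))] with s hs hs'
    have hs0 : s ≠ 0 := hs.2
    have hs' : e x + s • v ∈ e.target := hs'
    rw [slope_def_module]
    change v = (s - 0)⁻¹ • (e (e.symm (e x + s • v)) - e (e.symm (e x + (0 : ℝ) • v)))
    rw [e.right_inv hs', hx0]
    simp [hs0]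

end Velocities

/-! ### Absolutely continuous curves in manifolds -/

section AbsolutelyContinuousMaps

/-- If `t` is an endpoint of `I`, the segment stops at `t` on that side; nondegeneracy of `I`
excludes this on both sides at once. -/
theorem exists_Icc_subset_of_mem_nhdsWithin {I : Set ℝ} (hI : IsNondegInterval I) {t : ℝ}
    (ht : t ∈ I) {S : Set ℝ} (hS : S ∈ 𝓝[I] t) :
    ∃ α β : ℝ, α < β ∧ Icc α β ⊆ I ∧ Icc α β ⊆ S ∧ Icc α β ∈ 𝓝[I] t ∧ t ∈ Icc α β := by
  obtain ⟨ε, hε, hεS⟩ := Metric.mem_nhdsWithin_iff.1 hS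
  have hleft : ∃ α ∈ I, α ≤ t ∧ t - ε < α ∧ Ici α ∈ 𝓝[I] t ∧ (α = t → ∀ s ∈ I, t ≤ s) := by
    by_cases h : ∃ s ∈ I, s < t
    · obtain ⟨s, hsI, hst⟩ := h
      have hlt : max s (t - ε / 2) < t := max_lt hst (by linarith)
      refine ⟨max s (t - ε / 2), hI.1.out hsI ht ⟨le_max_left _ _, hlt.le⟩, hlt.le,
        lt_max_of_lt_right (by linarith), mem_nhdsWithin_of_mem_nhds (Ici_mem_nhds hlt),
        fun h => absurd h hlt.ne⟩
    · push Not at h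
      exact ⟨t, ht, le_rfl, by linarith, mem_of_superset self_mem_nhdsWithin h, fun _ => h⟩
  have hright : ∃ β ∈ I, t ≤ β ∧ β < t + ε ∧ Iic β ∈ 𝓝[I] t ∧ (β = t → ∀ s ∈ I, s ≤ t) := by
    by_cases h : ∃ s ∈ I, t < s
    · obtain ⟨s, hsI, hst⟩ := h
      have hlt : t < min s (t + ε / 2) := lt_min hst (by linarith)
      refine ⟨min s (t + ε / 2), hI.1.out ht hsI ⟨hlt.le, min_le_left _ _⟩, hlt.le,
        min_lt_of_right_lt (by linarith), mem_nhdsWithin_of_mem_nhds (Iic_mem_nhds hlt),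
        fun h => absurd h hlt.ne'⟩
    · push Not at h
      exact ⟨t, ht, le_rfl, by linarith, mem_of_superset self_mem_nhdsWithin h, fun _ => h⟩
  obtain ⟨α, hαI, hαt, hεα, hαn, hα⟩ := hleft
  obtain ⟨β, hβI, hβt, hεβ, hβn, hβ⟩ := hright
  have hsub : Icc α β ⊆ I := hI.1.out hαI hβI
  refine ⟨α, β, ?_, hsub, fun s hs => hεS ⟨?_, hsub hs⟩, ?_, hαt, hβt⟩
  · refine lt_of_le_of_ne (hαt.trans hβt) fun h => ?_
    have h1 : α = t := le_antisymm hαt (h ▸ hβt)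
    have h2 : β = t := by rw [← h, h1]
    obtain ⟨s, hs, hst⟩ := hI.2.exists_ne t
    exact hst (le_antisymm (hβ h2 s hs) (hα h1 s hs))
  · rw [Metric.mem_ball, Real.dist_eq, abs_lt]
    constructor <;> linarith [hs.1, hs.2]
  · exact inter_mem hαn hβn

variable {E : Type*} [AddCommGroup E] [Module ℝ E] [UniformSpace E] [IsFrechetSpace E]
  {F : Type*} [AddCommGroup F] [Module ℝ F] [UniformSpace F] [IsFrechetSpace F]
  {M : Type*} [TopologicalSpace M] [ChartedSpace E M]
  {N : Type*} [TopologicalSpace N] [ChartedSpace F N]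
  {c : ℝ → M} {I I' : Set ℝ}

/-- The chart segments can be shrunk into any relative neighbourhood `S`, which makes room for a
condition from a second chart or curve. -/
theorem IsAbsContMap.exists_Icc (h : IsAbsContMap E c I) (hI' : IsNondegInterval I')
    (hII' : I' ⊆ I) {t : ℝ} (ht : t ∈ I') {S : Set ℝ} (hS : S ∈ 𝓝[I'] t) :
    ∃ φ ∈ atlas E M, ∃ α β : ℝ, α < β ∧ Icc α β ⊆ I' ∧ Icc α β ⊆ S ∧ Icc α β ∈ 𝓝[I'] t ∧
      t ∈ Icc α β ∧ MapsTo c (Icc α β) φ.source ∧ IsAbsContIcc (φ ∘ c) α β := by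
  obtain ⟨φ, hφ, α, β, -, -, hn, hm, hac⟩ := h.2 t (hII' ht)
  obtain ⟨α', β', hαβ, h1, h2, h3, h4⟩ := exists_Icc_subset_of_mem_nhdsWithin hI' ht
    (inter_mem hS (nhdsWithin_mono t hII' hn))
  exact ⟨φ, hφ, α', β', hαβ, h1, h2.trans inter_subset_left, h3, h4,
    hm.mono_left (h2.trans inter_subset_right), hac.mono (h2.trans inter_subset_right)⟩

theorem IsAbsContMap.mono (h : IsAbsContMap E c I) (hI' : IsNondegInterval I') (hII' : I' ⊆ I) :
    IsAbsContMap E c I' := by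
  refine ⟨h.1.mono hII', fun t ht => ?_⟩
  obtain ⟨φ, hφ, α, β, hαβ, h1, -, h2, -, h3, h4⟩ := h.exists_Icc hI' hII' ht univ_mem
  exact ⟨φ, hφ, α, β, hαβ, h1, h2, h3, h4⟩

theorem IsAbsContMap.comp_isCkMapOn {f : M → N} (h : IsAbsContMap E c I)
    (hf : IsCkMapOn ⊤ E F f univ) (hI : IsNondegInterval I) : IsAbsContMap F (f ∘ c) I := by
  have hcont : ContinuousOn (f ∘ c) I := hf.1.comp h.1 (mapsTo_univ _ _)
  refine ⟨hcont, fun t ht => ?_⟩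
  set ψ := chartAt F (f (c t)) with hψ
  have hψa : ψ ∈ atlas F N := chart_mem_atlas _ _
  obtain ⟨φ, hφ, α, β, hαβ, h1, h2, h3, -, h4, h5⟩ := h.exists_Icc hI subset_rfl ht
    ((hcont t ht).eventually (ψ.open_source.mem_nhds (mem_chart_source F (f (c t)))))
  refine ⟨ψ, hψa, α, β, hαβ, h1, h3, h2, ?_⟩
  refine (IsAbsContIcc.comp_isCnOn (isOpen_chart_domain hf.1 φ ψ) (hf.isCnOn hφ hψa 2)
    (φ.continuousOn.comp (h.1.mono h1) h4) (fun s hs => ?_) h5).congr fun s hs => ?_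
  · refine ⟨φ.map_source (h4 hs), mem_univ _, ?_⟩
    have : f (c s) ∈ ψ.source := h2 hs
    simpa [φ.left_inv (h4 hs)] using this
  · simp [φ.left_inv (h4 hs)]

theorem IsAbsContMap.prodMk {d : ℝ → N} (h : IsAbsContMap E c I) (h' : IsAbsContMap F d I)
    (hI : IsNondegInterval I) : IsAbsContMap (E × F) (fun t => (c t, d t)) I := by
  refine ⟨h.1.prodMk h'.1, fun t ht => ?_⟩
  obtain ⟨φ, hφ, α, β, -, -, hn, hm, hac⟩ := h.2 t ht
  obtain ⟨ψ, hψ, α', β', hαβ, h1, h2, h3, -, h4, h5⟩ := h'.exists_Icc hI subset_rfl ht hn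
  exact ⟨φ.prod ψ, mem_image2_of_mem hφ hψ, α', β', hαβ, h1, h3,
    fun s hs => ⟨hm (h2 hs), h4 hs⟩, (hac.mono h2).prodMk h5⟩

/-- In a chart the curve is constant near each time, by the result for Fréchet spaces and
injectivity of the chart; connectedness of `I` makes this global. -/
theorem IsAbsContMap.eq_of_ae_velocity_zero (hM : IsFrechetManifold ⊤ E M)
    (hI : IsNondegInterval I) (h : IsAbsContMap E c I)
    (hv : ∀ᵐ t : ℝ, t ∈ I → HasVelocityWithinAt E c I t (0 : E)) {s t : ℝ} (hs : s ∈ I)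
    (ht : t ∈ I) : c s = c t := by
  refine hI.1.isPreconnected.induction₂ (fun s t => c s = c t) (fun r hr => ?_)
    (fun _ _ _ _ _ _ h h' => h.trans h') (fun _ _ _ _ h => h.symm) hs ht
  obtain ⟨φ, hφ, α, β, hαβ, h1, -, h3, h3', h4, h5⟩ := h.exists_Icc hI subset_rfl hr univ_mem
  have hconst := h5.eq_of_ae_slope_tendsto_zero (by
    filter_upwards [hv] with r hr hrI
    exact ((hr (h1 hrI)).tendsto_slope_zero hM (h.1 r (h1 hrI)) hφ (h4 hrI)).mono_left
      (nhdsWithin_mono _ (sdiff_subset_sdiff_left h1)))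
  filter_upwards [h3] with u hu
  exact φ.injOn (h4 h3') (h4 hu) ((hconst r h3').trans (hconst u hu).symm)

end AbsolutelyContinuousMaps

/-! ### Group actions and evolutions -/

section Actions

variable {E : Type uE} [AddCommGroup E] [Module ℝ E] [UniformSpace E]
  {F : Type uF} [AddCommGroup F] [Module ℝ F] [UniformSpace F]
  {G : Type uG} [Group G] [TopologicalSpace G] [ChartedSpace E G]
  {M : Type uM} [TopologicalSpace M] [ChartedSpace F M]
  {σ : M × G → M}

theorem IsFrechetLieGroup.isCkMapOn_mul_left (hG : IsFrechetLieGroup E G) (k : G) :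
    IsCkMapOn ⊤ E E (fun g : G => k * g) univ := by
  have := hG.manifold.frechet
  exact hG.smooth_mul.comp ((isCkMapOn_const k).prodMk hG.manifold.isCkMapOn_id)

theorem IsSmoothRightAction.isCkMapOn_orbit (hG : IsFrechetLieGroup E G)
    (hM : IsFrechetManifold ⊤ F M) (hσ : IsSmoothRightAction E F σ) (x : M) :
    IsCkMapOn ⊤ E F (fun g : G => σ (x, g)) univ := by
  have := hG.manifold.frechet
  have := hM.frechet
  exact hσ.smooth.comp ((isCkMapOn_const x).prodMk hG.manifold.isCkMapOn_id)

theorem IsSmoothRightAction.isCkMapOn_orbit_mul_left (hG : IsFrechetLieGroup E G)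
    (hM : IsFrechetManifold ⊤ F M) (hσ : IsSmoothRightAction E F σ) (x : M) (k : G) :
    IsCkMapOn ⊤ E F (fun g : G => σ (x, k * g)) univ := by
  have := hG.manifold.frechet
  have := hM.frechet
  exact (hσ.isCkMapOn_orbit hG hM x).comp (hG.isCkMapOn_mul_left k)

theorem IsSmoothRightAction.isCkMapOn_act_inv (hG : IsFrechetLieGroup E G)
    (hM : IsFrechetManifold ⊤ F M) (hσ : IsSmoothRightAction E F σ) :
    IsCkMapOn ⊤ (F × E) F (fun p : M × G => σ (p.1, p.2⁻¹)) univ := by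
  have := hG.manifold.frechet
  have := hM.frechet
  exact hσ.smooth.comp (hM.isCkMapOn_fst.prodMk
    (hG.smooth_inv.comp hG.manifold.isCkMapOn_snd))

theorem IsSmoothRightAction.isCkMapOn_act_inv_mul (hG : IsFrechetLieGroup E G)
    (hM : IsFrechetManifold ⊤ F M) (hσ : IsSmoothRightAction E F σ) :
    IsCkMapOn ⊤ (E × E × F) F (fun p : G × G × M => σ (p.2.2, p.2.1⁻¹ * p.1)) univ := by
  have := hG.manifold.frechet
  have := hM.frechet
  have h2 : IsCkMapOn ⊤ (E × E × F) (E × F) (fun p : G × G × M => p.2) univ :=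
    (hG.manifold.prod hM).isCkMapOn_snd
  have h1 : IsCkMapOn ⊤ (E × E × F) E (fun p : G × G × M => p.1) univ :=
    hG.manifold.isCkMapOn_fst
  have h21 : IsCkMapOn ⊤ (E × E × F) E (fun p : G × G × M => p.2.1) univ :=
    hG.manifold.isCkMapOn_fst.comp h2
  have h22 : IsCkMapOn ⊤ (E × E × F) F (fun p : G × G × M => p.2.2) univ :=
    hM.isCkMapOn_snd.comp h2
  exact hσ.smooth.comp (h22.prodMk (hG.smooth_mul.comp ((hG.smooth_inv.comp h21).prodMk h1)))

/-- The map `g ↦ x.(k g)` sends the left translate `g.v` to the fundamental vector `v_♯`. -/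
theorem IsSmoothRightAction.tangentMapAt_orbit_mul_left (hG : IsFrechetLieGroup E G)
    (hM : IsFrechetManifold ⊤ F M) (hσ : IsSmoothRightAction E F σ) (x : M) (k g : G) (v : E) :
    (tangentMapAt E F (fun g' : G => σ (x, k * g')) g
      (tangentMapAt E E (fun h : G => g * h) 1 v) : F) =
      fundamentalVectorField E F σ v (σ (x, k * g)) := by
  have := hG.manifold.frechet
  have := hM.frechet
  -- Both sides are velocities at `0` of the same curve, because `x.(k(g h(s))) = (x.(k g)).h(s)`.
  obtain ⟨h, h0, hc, hv⟩ := exists_curve_hasVelocityWithinAt (1 : G) v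
  have h1 := (hG.isCkMapOn_mul_left g).hasVelocityWithinAt hc.continuousWithinAt h0 hv
  have hc1 : ContinuousWithinAt ((fun h : G => g * h) ∘ h) univ 0 :=
    ((continuousOn_univ.1 (hG.isCkMapOn_mul_left g).1).continuousAt.comp hc).continuousWithinAt
  have h2 := (hσ.isCkMapOn_orbit_mul_left hG hM x k).hasVelocityWithinAt hc1
    (x := g) (by simp [h0]) h1
  have h3 := (hσ.isCkMapOn_orbit hG hM (σ (x, k * g))).hasVelocityWithinAt hc.continuousWithinAt
    h0 hv
  have heq : (fun g' : G => σ (x, k * g')) ∘ ((fun h : G => g * h) ∘ h) =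
      (fun g' : G => σ (σ (x, k * g), g')) ∘ h := by
    funext s
    simp only [Function.comp_apply, ← hσ.act_mul, mul_assoc]
  rw [heq] at h2
  exact h2.unique (by rw [← compl_eq_univ_sdiff]; infer_instance) h3

/-- The map `(x, g) ↦ x.g⁻¹` annihilates the tangent vectors `(v_♯(x), g.v)`. -/
theorem IsSmoothRightAction.tangentMapAt_act_inv (hG : IsFrechetLieGroup E G)
    (hM : IsFrechetManifold ⊤ F M) (hσ : IsSmoothRightAction E F σ) (x : M) (g : G) (v : E) :
    (tangentMapAt (F × E) F (fun p : M × G => σ (p.1, p.2⁻¹)) (x, g)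
      (fundamentalVectorField E F σ v x, tangentMapAt E E (fun h : G => g * h) 1 v) : F) = 0 := by
  have := hG.manifold.frechet
  have := hM.frechet
  obtain ⟨h, h0, hc, hv⟩ := exists_curve_hasVelocityWithinAt (1 : G) v
  have h1 := (hG.isCkMapOn_mul_left g).hasVelocityWithinAt hc.continuousWithinAt h0 hv
  have h2 := (hσ.isCkMapOn_orbit hG hM x).hasVelocityWithinAt hc.continuousWithinAt h0 hv
  have hc1 : ContinuousAt ((fun h : G => g * h) ∘ h) 0 :=
    (continuousOn_univ.1 (hG.isCkMapOn_mul_left g).1).continuousAt.comp hc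
  have hc2 : ContinuousAt ((fun h : G => σ (x, h)) ∘ h) 0 :=
    (continuousOn_univ.1 (hσ.isCkMapOn_orbit hG hM x).1).continuousAt.comp hc
  have h3 := (hσ.isCkMapOn_act_inv hG hM).hasVelocityWithinAt
    (hc2.prodMk hc1).continuousWithinAt (x := (x, g)) (by simp [h0, hσ.act_one]) (h2.prodMk h1)
  -- `(x.h(s)).(g h(s))⁻¹ = x.(h(s) h(s)⁻¹ g⁻¹) = x.g⁻¹`: the image curve is constant.
  have heq : (fun p : M × G => σ (p.1, p.2⁻¹)) ∘ (fun s => (((fun h : G => σ (x, h)) ∘ h) s,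
      ((fun h : G => g * h) ∘ h) s)) = fun _ => σ (x, g⁻¹) := by
    funext s
    simp [← hσ.act_mul]
  rw [heq] at h3
  refine h3.unique (by rw [← compl_eq_univ_sdiff]; infer_instance) ?_
  refine tendsto_const_nhds.congr fun s => ?_
  simp [slope_def_module]

variable {a b : ℝ} {γ : ℝ → TangentAt E (1 : G)} {η : ℝ → G}

/-- Stated at a single time: the exceptional times depend on `η` alone, not on `x` or `k`, which
yields a common set of full measure for all initial data. -/
theorem IsSmoothRightAction.hasVelocityWithinAt_orbit (hG : IsFrechetLieGroup E G)
    (hM : IsFrechetManifold ⊤ F M) (hσ : IsSmoothRightAction E F σ) (x : M) (k : G) {I : Set ℝ}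
    {t : ℝ} {v : E} (hη : ContinuousWithinAt η I t)
    (hv : HasVelocityWithinAt E η I t (tangentMapAt E E (fun h : G => η t * h) 1 v)) :
    HasVelocityWithinAt F (fun s => σ (x, k * η s)) I t
      (fundamentalVectorField E F σ v (σ (x, k * η t))) := by
  have := hG.manifold.frechet
  have := hM.frechet
  have h := (hσ.isCkMapOn_orbit_mul_left hG hM x k).hasVelocityWithinAt hη rfl hv
  rw [hσ.tangentMapAt_orbit_mul_left hG hM] at h
  exact h

theorem IsEvolution.isCaratheodorySolIVP_orbit (hG : IsFrechetLieGroup E G)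
    (hM : IsFrechetManifold ⊤ F M) (hσ : IsSmoothRightAction E F σ)
    (hη : IsEvolution E a b γ η) {t₀ : ℝ} (ht₀ : t₀ ∈ Icc a b) (y₀ : M) :
    IsCaratheodorySolIVP (Icc a b ×ˢ (univ : Set M))
      (fun t => fundamentalVectorField E F σ (γ t)) t₀ y₀ (Icc a b)
      (fun t => σ (y₀, (η t₀)⁻¹ * η t)) := by
  have := hG.manifold.frechet
  have := hM.frechet
  obtain ⟨⟨hI, hac, -, hv⟩, -, -⟩ := hη
  refine ⟨⟨hI, hac.comp_isCkMapOn (f := fun g => σ (y₀, (η t₀)⁻¹ * g))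
    (hσ.isCkMapOn_orbit_mul_left hG hM y₀ (η t₀)⁻¹) hI,
    fun t ht => ⟨ht, mem_univ _⟩, ?_⟩, ht₀, by simp [hσ.act_one]⟩
  filter_upwards [hv] with t ht htI
  exact hσ.hasVelocityWithinAt_orbit hG hM y₀ _ (hac.1 t htI) (ht htI)

/-- Every solution is of the form `t ↦ y(s).(η(s)⁻¹ η(t))`. -/
theorem IsEvolution.eq_of_isCaratheodorySol (hG : IsFrechetLieGroup E G)
    (hM : IsFrechetManifold ⊤ F M) (hσ : IsSmoothRightAction E F σ)
    (hη : IsEvolution E a b γ η) {I : Set ℝ} {y : ℝ → M}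
    (hy : IsCaratheodorySol (Icc a b ×ˢ (univ : Set M))
      (fun t => fundamentalVectorField E F σ (γ t)) I y) {s t : ℝ} (hs : s ∈ I) (ht : t ∈ I) :
    y t = σ (y s, (η s)⁻¹ * η t) := by
  have := hG.manifold.frechet
  have := hM.frechet
  obtain ⟨⟨-, hac, -, hv⟩, -, -⟩ := hη
  obtain ⟨hI, hyac, hyW, hyv⟩ := hy
  have hsub : I ⊆ Icc a b := fun r hr => (hyW r hr).1
  have hηac := hac.mono hI hsub
  -- The invariant `t ↦ y(t).η(t)⁻¹`, absolutely continuous as a smooth image of `(y, η)`.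
  have hz := (hyac.prodMk hηac hI).comp_isCkMapOn (hσ.isCkMapOn_act_inv hG hM) hI
  have hconst := hz.eq_of_ae_velocity_zero hM hI (by
    filter_upwards [hv, hyv] with r hr hyr hrI
    have hvel : HasVelocityWithinAt E η I r (tangentMapAt E E (fun h : G => η r * h) 1 (γ r)) :=
      (hr (hsub hrI)).mono_left (nhdsWithin_mono _ (sdiff_subset_sdiff_left hsub))
    have h := (hσ.isCkMapOn_act_inv hG hM).hasVelocityWithinAt
      ((hyac.1 r hrI).prodMk (hηac.1 r hrI)) rfl ((hyr hrI).prodMk hvel)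
    rw [hσ.tangentMapAt_act_inv hG hM] at h
    exact h) ht hs
  have hconst : σ (y t, (η t)⁻¹) = σ (y s, (η s)⁻¹) := hconst
  rw [hσ.act_mul, ← hconst, ← hσ.act_mul, inv_mul_cancel, hσ.act_one]

end Actions

/-! ### The main theorem -/

theorem theorem1p2
    {E : Type uE} [AddCommGroup E] [Module ℝ E] [UniformSpace E]
    {F : Type uF} [AddCommGroup F] [Module ℝ F] [UniformSpace F]
    {G : Type uG} [Group G] [TopologicalSpace G] [ChartedSpace E G]
    {M : Type uM} [TopologicalSpace M] [ChartedSpace F M]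
    (hG : IsFrechetLieGroup E G) (hM : IsFrechetManifold ⊤ F M)
    (σ : M × G → M) (hσ : IsSmoothRightAction E F σ)
    (a b : ℝ) (hab : a < b)
    (γ : ℝ → TangentAt E (1 : G)) (hγ : IsL1On γ a b)
    (η : ℝ → G) (hη : IsEvolution E a b γ η) :
    LocalExistence (Icc a b) (Icc a b ×ˢ (univ : Set M))
      (fun t => fundamentalVectorField E F σ (γ t)) ∧
    LocalUniqueness (Icc a b ×ˢ (univ : Set M))
      (fun t => fundamentalVectorField E F σ (γ t)) ∧
    IsMaximalFlow (Icc a b ×ˢ (univ : Set M))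
      (fun t => fundamentalVectorField E F σ (γ t))
      (Icc a b ×ˢ Icc a b ×ˢ (univ : Set M))
      (fun p => σ (p.2.2, (η p.2.1)⁻¹ * η p.1)) ∧
    AdmitsLocalFlows.{uF, uM, uE, uG} ⊤ (Icc a b) (Icc a b ×ˢ (univ : Set M))
      (fun t => fundamentalVectorField E F σ (γ t)) := by
  have hrel : IsRelOpen (Icc a b) (Icc a b) := ⟨univ, isOpen_univ, (inter_univ _).symm⟩
  refine ⟨?_, ?_, ⟨fun p hp => hp.2, ?_⟩, ?_⟩
  · rintro ⟨t₀, y₀⟩ ⟨ht₀, -⟩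
    exact ⟨Icc a b, _, hrel, hη.isCaratheodorySolIVP_orbit hG hM hσ ht₀ y₀⟩
  · rintro I₁ I₂ y₁ y₂ h₁ h₂ t₀ ⟨ht₁, ht₂⟩ h₀
    -- Uniqueness even holds on the whole common interval, since both solutions obey the same
    -- formula.
    refine ⟨I₁ ∩ I₂, h₁.1.1.inter h₂.1.1, ⟨univ, isOpen_univ, (inter_univ _).symm⟩, ⟨ht₁, ht₂⟩,
      fun t ht => ?_⟩
    rw [hη.eq_of_isCaratheodorySol hG hM hσ h₁ ht₁ ht.1,
      hη.eq_of_isCaratheodorySol hG hM hσ h₂ ht₂ ht.2, h₀]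
  · rintro t₀ y₀ ⟨ht₀, -⟩
    have hset : {t | (t, t₀, y₀) ∈ Icc a b ×ˢ Icc a b ×ˢ (univ : Set M)} = Icc a b := by
      ext t
      exact ⟨fun h => h.1, fun h => ⟨h, ht₀, mem_univ _⟩⟩
    rw [hset]
    refine ⟨hη.isCaratheodorySolIVP_orbit hG hM hσ ht₀ y₀, fun I y hy => ?_⟩
    obtain ⟨hy, ht₀I, hy₀⟩ := hy
    refine ⟨fun t ht => (hy.2.2.1 t ht).1, fun t ht => ?_⟩
    rw [hη.eq_of_isCaratheodorySol hG hM hσ hy ht₀I ht, hy₀]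
  · rintro ⟨t₁, y₁⟩ ⟨ht₁, -⟩
    have hac := hη.1.2.1
    -- The flow is global, so `I = [a,b]` and `V = Y = M` serve at every point.
    refine ⟨Icc a b, univ, fun t t₀ y₀ => σ (y₀, (η t₀)⁻¹ * η t), ordConnected_Icc, hrel, ht₁,
      isOpen_univ, mem_univ _, subset_rfl,
      fun t₀ ht₀ y₀ _ => hη.isCaratheodorySolIVP_orbit hG hM hσ ht₀ y₀,
      ⟨univ, isOpen_univ, mem_univ _, subset_rfl, fun _ _ _ _ => mapsTo_univ _ _,
        fun t₀ _ t₁ _ t₂ _ y₀ _ => ?_⟩, ?_, ?_⟩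
    · change σ (σ (y₀, (η t₀)⁻¹ * η t₁), (η t₁)⁻¹ * η t₂) = σ (y₀, (η t₀)⁻¹ * η t₂)
      rw [← hσ.act_mul]
      congr 2
      group
    -- `N₁ = N₂ = G`, `ζ₁ = ζ₂ = η` and `Ψ(g,h,x) = x.(h⁻¹ g)`.
    · refine ⟨E, inferInstance, inferInstance, inferInstance, G, inferInstance, inferInstance,
        E, inferInstance, inferInstance, inferInstance, G, inferInstance, inferInstance, η, η,
        fun p => σ (p.2.2, p.2.1⁻¹ * p.1), hG.manifold, hG.manifold, hac, hac, ?_,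
        fun _ _ _ _ _ _ => rfl⟩
      rw [univ_prod_univ, univ_prod_univ]
      exact hσ.isCkMapOn_act_inv_mul hG hM
    · have hv := hη.1.2.2.2
      set B := {t | ¬ (t ∈ Icc a b → HasVelocityWithinAt E η (Icc a b) t
        (tangentMapAt E E (fun h : G => η t * h) 1 (γ t)))} with hB
      have hB0 : volume B = 0 := hv
      -- The null set `B` of bad times of `η` need not be Borel; it is enlarged to a measurable null
      -- set before being removed.
      obtain ⟨B', hBB', hB'm, hB'0⟩ := exists_measurable_superset_of_null hB0
      refine ⟨Icc a b \ B', sdiff_subset, measurableSet_Icc.diff hB'm,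
        measure_mono_null (fun t ht => ?_) hB'0, fun y₀ _ t₀ _ t ht => ?_⟩
      · by_contra h
        exact ht.2 ⟨ht.1, h⟩
      · refine hσ.hasVelocityWithinAt_orbit hG hM y₀ _ (hac.1 t ht.1) ?_
        by_contra h
        exact ht.2 (hBB' fun h' => h (h' ht.1))
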